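/- **Setting.** Let $(X,d)$ be a bounded metric space and $\mu$ a non-negative Borel measure on $X$ with $0<\mu(B(x,r))<\infty$ for every open ball of radius $r\in(0,\infty)$. An *exponent* is a measurable $q:X\to(0,\infty]$ with $q^-:=\operatorname{ess\,inf}q>0$; we write $q^+:=\operatorname{ess\,sup}q$, $\mathcal P(X)$ for the set of exponents, and $\mathcal P_b^{\log}(X)$ for the exponents $p$ with $p^+<\infty$ such that $|1/p(x)-1/p(y)|\le C/\log(e+1/d(x,y))$ for all $x,y\in X$ and some constant $C$. For bounded functions, $f\gg h$ (or $h\ll f$) means $\operatorname{ess\,inf}(f-h)>0$. Put $\rho_{p(\cdot)}(f)=\int_X|f(x)|^{p(x)}d\mu(x)$ and $\|f\|_{L^{p(\cdot)}}=\inf\{\lambda>0:\rho_{p(\cdot)}(f/\lambda)\le1\}$, and let $L^{p(\cdot)}$ be the set of measurable $f$ with $\rho_{p(\cdot)}(f)<\infty$. For a sequence $g=(g_k)_{k\in\mathbb Z}$ in $L^{p(\cdot)}$ put (with $\lambda^{1/\infty}=1$, $\inf\emptyset=\infty$) $$\rho_{\ell^{q(\cdot)}(L^{p(\cdot)})}(g)=\sum_{k\in\mathbb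 Z}\inf\{\lambda_k>0:\rho_{p(\cdot)}(g_k/\lambda_k^{1/q(\cdot)})\le1\},\qquad \|g\|_{\ell^{q(\cdot)}(L^{p(\cdot)})}=\inf\{\lambda>0:\rho_{\ell^{q(\cdot)}(L^{p(\cdot)})}(g/\lambda)\le1\},$$ and let $\ell^{q(\cdot)}(L^{p(\cdot)})$ be the set of such $g$ with $\rho_{\ell^{q(\cdot)}(L^{p(\cdot)})}(g/\lambda)<\infty$ for some $\lambda>0$. For a measurable, a.e. finite $u:X\to[-\infty,\infty]$, let $\mathbb D^{s(\cdot)}(u)$ be the set of sequences $(g_k)_{k\in\mathbb Z}$ of non-negative measurable functions for which there is a null set $N$ such that $$|u(x)-u(y)|\le d(x,y)^{s(x)}g_k(x)+d(x,y)^{s(y)}g_k(y)$$ for all $k\in\mathbb Z$ and $x,y\in X\setminus N$ with $2^{-k-1}\le d(x,y)<2^{-k}$. The homogeneous Hajłasz–Besov space $\dot N^{s(\cdot)}_{p(\cdot),q(\cdot)}$ consists of all such $u$ with $\inf_{g\in\mathbb D^{s(\cdot)}(u)}\|g\|_{\ell^{q(\cdot)}(L^{p(\cdot)})}<\infty$,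 and $N^{s(\cdot)}_{p(\cdot),q(\cdot)}:=\dot N^{s(\cdot)}_{p(\cdot),q(\cdot)}\cap L^{p(\cdot)}$. **Theorem.** Let $Q\in\mathcal P_b^{\log}(X)$, $\delta\in(0,\infty)$ and $b\in(0,1]$ be such that $\mu(B(x,r))\ge b\,r^{Q(x)}$ for all $x\in X$ and $r\in(0,\delta]$. Let $p,s,\varepsilon\in\mathcal P_b^{\log}(X)$ with $\varepsilon\ll s$, and let $q\in\mathcal P(X)$ be arbitrary. All constants below are positive and depend only on $b$, $\delta$, $\operatorname{diam}X$ and the exponents $p,s,Q,\varepsilon$, and in (i) also on $\mu(X)$. They depend on the exponents only through a common positive lower bound, a common upper bound and a common log-Hölder constant (for the reciprocals) of $p,s,Q,\varepsilon$, and through a positive lower bound for $(s-\varepsilon)^-$ and, in (i) and (iii) respectively, for $(Q-\varepsilon p)^-$ and $(\varepsilon p-Q)^-$. In particular they do not depend on $q$, $u$, $g$. 1. (i) If $\varepsilon p\ll Q$ and $\gamma_\varepsilon:=\frac{Qp}{Q-\varepsilon p}$, then there is a constant $C_S$ such that for all $u\in\dot N^{s(\cdot)}_{p(\cdot),q(\cdot)}$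 and $g\in\mathbb D^{s(\cdot)}(u)\cap\ell^{q(\cdot)}(L^{p(\cdot)})$, $$\inf_{c\in\mathbb R}\|u-c\|_{L^{\gamma_\varepsilon(\cdot)}}\le C_S\|g\|_{\ell^{q(\cdot)}(L^{p(\cdot)})},$$ and for all $u\in N^{s(\cdot)}_{p(\cdot),q(\cdot)}$ and $g\in\mathbb D^{s(\cdot)}(u)\cap\ell^{q(\cdot)}(L^{p(\cdot)})$, $$\|u\|_{L^{\gamma_\varepsilon(\cdot)}}\le C_S\big(\|u\|_{L^{p(\cdot)}}+\|g\|_{\ell^{q(\cdot)}(L^{p(\cdot)})}\big).$$ 2. (ii) If $\varepsilon p=Q$, then there are constants $C_{MT1},C_{MT2}$ such that for all $u\in\dot N^{s(\cdot)}_{p(\cdot),q(\cdot)}$ and $g\in\mathbb D^{s(\cdot)}(u)\cap\ell^{q(\cdot)}(L^{p(\cdot)})$ with $\|g\|_{\ell^{q(\cdot)}(L^{p(\cdot)})}>0$, the function $u$ is integrable and, with $u_X:=\frac1{\mu(X)}\int_X u\,d\mu$, $$\frac1{\mu(X)}\int_X\exp\Big(C_{MT1}\frac{|u(x)-u_X|}{\|g\|_{\ell^{q(\cdot)}(L^{p(\cdot)})}}\Big)d\mu(x)\le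 C_{MT2}.$$ 3. (iii) If $\varepsilon p\gg Q$ and $\alpha_\varepsilon:=\varepsilon-\frac Qp$, then there are constants $C_H,D_H$ such that for all $u\in\dot N^{s(\cdot)}_{p(\cdot),q(\cdot)}$ and $g\in\mathbb D^{s(\cdot)}(u)\cap\ell^{q(\cdot)}(L^{p(\cdot)})$, the function $u$ is integrable, $$\|u-u_X\|_{L^\infty}\le C_H\|g\|_{\ell^{q(\cdot)}(L^{p(\cdot)})},$$ and there is a continuous $\tilde u:X\to\mathbb R$ with $\tilde u=u$ a.e. and, for all $x,y\in X$, $$|\tilde u(x)-\tilde u(y)|\le D_H\|g\|_{\ell^{q(\cdot)}(L^{p(\cdot)})}\,d(x,y)^{\alpha_\varepsilon(x)}.$$ -/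

import Mathlib

open MeasureTheory Set
open scoped ENNReal NNReal

universe u

noncomputable section

namespace VarBesov

/-! ## Variable exponents -/

section Exponents

variable {X : Type u}

/-- `q` is a variable exponent on `X`: a measurable function `q : X → (0, ∞]` with
`q⁻ = ess inf q > 0`. -/
structure IsExponent [MeasurableSpace X] (μ : Measure X) (q : X → ℝ≥0∞) : Prop where
  measurable : Measurable q
  pos : ∀ x, 0 < q x
  essInf_pos : 0 < essInf q μ

/-- `f` is locally log-Hölder continuous on `X` with constant `L`:
`|f x - f y| ≤ L / log (e + 1 / d(x, y))`.
For `x = y` this reads `0 ≤ L`, whichever value is given to `1 / 0`. -/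
def LogHolderWith [MetricSpace X] (L : ℝ) (f : X → ℝ) : Prop :=
  ∀ x y, |f x - f y| ≤ L / Real.log (Real.exp 1 + 1 / dist x y)

/-- `p` is a bounded exponent whose reciprocal is locally log-Hölder continuous, with the
quantitative information `a ≤ p⁻`, `p⁺ ≤ A` and `C_log(1/p) ≤ L`. A positive function `p` belongs
to the class of bounded log-Hölder exponents iff this holds for some `a > 0`, `A` and `L`. -/
structure IsLogExponent [MetricSpace X] [MeasurableSpace X] (μ : Measure X) (a A L : ℝ)
    (p : X → ℝ) : Prop where
  measurable : Measurable p
  pos : ∀ x, 0 < p x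
  ess_lower : ∀ᵐ x ∂μ, a ≤ p x
  ess_upper : ∀ᵐ x ∂μ, p x ≤ A
  logHolder : LogHolderWith L (fun x => 1 / p x)

end Exponents

/-! ## Variable Lebesgue spaces and mixed Lebesgue sequence spaces

All quantities depend on a function only through its absolute value, so they are defined for
functions with values in `[0, ∞]`. Infima over the empty set are `∞`. -/

section Lebesgue

variable {X : Type u} [MeasurableSpace X]

/-- The semi-modular `ρ_{p(·)}(f) = ∫ f(x)^{p(x)} dμ(x)`. -/
def modular (μ : Measure X) (p : X → ℝ) (f : X → ℝ≥0∞) : ℝ≥0∞ :=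
  ∫⁻ x, f x ^ p x ∂μ

/-- The Luxemburg quasi-norm `inf {l ∈ (0, ∞) : ρ_{p(·)}(f / l) ≤ 1}`. -/
def luxNorm (μ : Measure X) (p : X → ℝ) (f : X → ℝ≥0∞) : ℝ≥0∞ :=
  ⨅ (l : ℝ) (_ : 0 < l) (_ : modular μ p (fun x => f x / ENNReal.ofReal l) ≤ 1),
    ENNReal.ofReal l

/-- Membership of `f` in `L^{p(·)}(X, μ)`. -/
def MemVarLp (μ : Measure X) (p : X → ℝ) (f : X → ℝ≥0∞) : Prop :=
  Measurable f ∧ modular μ p f < ∞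

/-- The semi-modular of `ℓ^{q(·)}(L^{p(·)})`:
`∑_{k ∈ ℤ} inf {l > 0 : ρ_{p(·)}(g_k / l^{1/q(·)}) ≤ 1}`, where `l^{1/∞} = 1`. -/
def mixedModular (μ : Measure X) (p : X → ℝ) (q : X → ℝ≥0∞) (g : ℤ → X → ℝ≥0∞) : ℝ≥0∞ :=
  ∑' k : ℤ, ⨅ (l : ℝ) (_ : 0 < l)
    (_ : modular μ p (fun x => g k x / ENNReal.ofReal (l ^ ((q x)⁻¹).toReal)) ≤ 1),
    ENNReal.ofReal l

/-- The quasi-norm of `ℓ^{q(·)}(L^{p(·)})`. -/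
def mixedNorm (μ : Measure X) (p : X → ℝ) (q : X → ℝ≥0∞) (g : ℤ → X → ℝ≥0∞) : ℝ≥0∞ :=
  ⨅ (l : ℝ) (_ : 0 < l)
    (_ : mixedModular μ p q (fun k x => g k x / ENNReal.ofReal l) ≤ 1),
    ENNReal.ofReal l

/-- Membership of a sequence in `ℓ^{q(·)}(L^{p(·)}(X, μ))`. -/
def MemMixed (μ : Measure X) (p : X → ℝ) (q : X → ℝ≥0∞) (g : ℤ → X → ℝ≥0∞) : Prop :=
  (∀ k, MemVarLp μ p (g k)) ∧
    ∃ l : ℝ, 0 < l ∧ mixedModular μ p q (fun k x => g k x / ENNReal.ofReal l) < ∞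

end Lebesgue

/-! ## Hajłasz–Besov spaces -/

section Besov

variable {X : Type u} [MetricSpace X] [MeasurableSpace X]

/-- Measurable functions `X → [-∞, ∞]` which are finite almost everywhere. -/
def MeasFiniteAE (μ : Measure X) (u : X → EReal) : Prop :=
  Measurable u ∧ ∀ᵐ x ∂μ, u x ≠ ⊤ ∧ u x ≠ ⊥

/-- `g = (g_k)_{k ∈ ℤ}` is a vector `s(·)`-gradient of `u`. -/
def IsVectorGradient (μ : Measure X) (s : X → ℝ) (u : X → EReal) (g : ℤ → X → ℝ≥0∞) : Prop :=
  (∀ k, Measurable (g k)) ∧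
    ∃ N : Set X, μ N = 0 ∧ ∀ (k : ℤ) (x y : X), x ∉ N → y ∉ N →
      (2 : ℝ) ^ (-k - 1) ≤ dist x y → dist x y < (2 : ℝ) ^ (-k) →
      (u x - u y).abs ≤
        ENNReal.ofReal (dist x y ^ s x) * g k x + ENNReal.ofReal (dist x y ^ s y) * g k y

/-- The quasi-semi-norm of the homogeneous Hajłasz–Besov space: the infimum of the
`ℓ^{q(·)}(L^{p(·)})` quasi-norms of the vector `s(·)`-gradients of `u`. -/
def homBesovNorm (μ : Measure X) (s p : X → ℝ) (q : X → ℝ≥0∞) (u : X → EReal) : ℝ≥0∞ :=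
  ⨅ (g : ℤ → X → ℝ≥0∞) (_ : IsVectorGradient μ s u g) (_ : MemMixed μ p q g),
    mixedNorm μ p q g

/-- Membership in the homogeneous Hajłasz–Besov space. -/
def MemHomBesov (μ : Measure X) (s p : X → ℝ) (q : X → ℝ≥0∞) (u : X → EReal) : Prop :=
  MeasFiniteAE μ u ∧ homBesovNorm μ s p q u < ∞

/-- Membership in the inhomogeneous Hajłasz–Besov space, the intersection of the homogeneous one
with `L^{p(·)}`. -/
def MemBesov (μ : Measure X) (s p : X → ℝ) (q : X → ℝ≥0∞) (u : X → EReal) : Prop :=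
  MemHomBesov μ s p q u ∧ MemVarLp μ p (fun x => (u x).abs)

/-- The mean value `u_X` of `u` over `X`. -/
def mean (μ : Measure X) (u : X → EReal) : ℝ :=
  ⨍ x, (u x).toReal ∂μ

/-- The standing assumptions: `(X, d, μ)` is a bounded metric measure space of diameter `D`, all
of whose balls of positive radius have positive finite measure; `μ(B(x, r)) ≥ b r^{Q(x)}` for all
`r ∈ (0, δ]`; the exponents `Q, p, s, ε` are bounded log-Hölder exponents (with common bounds
`a, A` and common log-Hölder constant `L`), and `ess inf (s - ε) ≥ κ`. -/
structure Setting [BorelSpace X] (μ : Measure X) (b δ D a A L κ : ℝ) (Q p s ε : X → ℝ) :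
    Prop where
  bounded : Bornology.IsBounded (univ : Set X)
  diam_eq : Metric.diam (univ : Set X) = D
  ball_pos : ∀ (x : X) (r : ℝ), 0 < r → 0 < μ (Metric.ball x r)
  ball_lt_top : ∀ (x : X) (r : ℝ), 0 < r → μ (Metric.ball x r) < ∞
  lower_regular : ∀ (x : X) (r : ℝ), 0 < r → r ≤ δ →
    ENNReal.ofReal (b * r ^ Q x) ≤ μ (Metric.ball x r)
  exponent_Q : IsLogExponent μ a A L Q
  exponent_p : IsLogExponent μ a A L p
  exponent_s : IsLogExponent μ a A L s
  exponent_ε : IsLogExponent μ a A L ε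
  gap : ∀ᵐ x ∂μ, κ ≤ s x - ε x

end Besov

end VarBesov

end

open VarBesov

/-! All three cases follow from one pointwise argument for a single scalar gradient.

Reduction. If `l` exceeds the mixed norm of `g`, then every `g k / l` has `p`-modular at most 1;
this uniform bound is the only trace of `q` that is kept. Since `s - ε ≥ κ > 0`, lowering the
smoothness from `s` to `ε` yields weights decaying geometrically in `k`, and boundedness of the
space leaves only indices `k ≥ -m`. The weighted supremum `h` of the `g k` is then an ordinary
Hajłasz gradient of order `ε`, and the modular of `h / l` is at most a constant `K`
(`exists_hajlaszPair`).

Chaining. Put `v = u / l`, `H = h / l`. By Chebyshev and `μ(B(x, r)) ≥ b r^Q(x)`, each small ball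
contains a point where `H ≤ T r^(-Q(x)/p(x))` (`exists_good_point`); log-Hölder continuity allows
all exponents to be frozen at the centre. Telescoping over such points at scales `r 2^(-j)`, `j ≤
J`, bounds the distance of `v x` from a reference value by `∑ (r 2^(-j))^β + (r 2^(-J))^ε(x) H(x)`,
where `β = ε(x) - Q(x)/p(x)` (`exists_chain`).

The sign of `β` decides the rest. If `β < 0`, the last term dominates the sum, and the optimal `J`
gives `max(1, H)^(1 - εp/Q)`, whose power `γ_ε` is `max(1, H)^p`. If `β = 0`, the sum is `J + 1`,
and `J` of order `log H` gives a logarithm, so the exponential is integrable. If `β > 0`, the series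
converges, `J → ∞` removes `H(x)`, and Hölder continuity results. Finally `l` decreases to the norm,
except in the critical case, where `l` is twice the norm. -/

namespace VarBesov

/-! ### Log-Hölder continuity as a bound on oscillation at scale `r` -/

section LogComparable

variable {X : Type u} [MetricSpace X]

/-- `f` oscillates by at most `M / log (1 / r)` on balls of radius `r ≤ 1`. -/
def LogComparable (M : ℝ) (f : X → ℝ) : Prop :=
  ∀ x y r, 0 < r → r ≤ 1 → dist x y ≤ r → |f x - f y| * (-Real.log r) ≤ M

theorem LogHolderWith.logComparable {L : ℝ} {f : X → ℝ} (h : LogHolderWith L f) :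
    LogComparable (max L 0) f := by
  intro x y r hr hr1 hd
  rcases eq_or_ne x y with rfl | hxy
  · simp
  have hd0 : 0 < dist x y := dist_pos.2 hxy
  have hlog : -Real.log r ≤ Real.log (Real.exp 1 + 1 / dist x y) := by
    rw [← Real.log_inv]
    apply Real.log_le_log (by positivity)
    have : r⁻¹ ≤ 1 / dist x y := by
      rw [one_div]; exact inv_anti₀ hd0 hd
    linarith [Real.exp_pos 1]
  have hlog0 : 0 < Real.log (Real.exp 1 + 1 / dist x y) := by
    apply Real.log_pos
    have : 0 < 1 / dist x y := by positivity
    linarith [Real.add_one_le_exp (1 : ℝ)]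
  calc |f x - f y| * (-Real.log r)
      ≤ |f x - f y| * Real.log (Real.exp 1 + 1 / dist x y) := by gcongr
    _ ≤ L := (le_div_iff₀ hlog0).1 (h x y)
    _ ≤ max L 0 := le_max_left _ _

theorem LogComparable.continuous {M : ℝ} {f : X → ℝ} (h : LogComparable M f) :
    Continuous f := by
  rw [Metric.continuous_iff]
  intro y η hη
  have hM : 0 ≤ M := by simpa using h y y 1 one_pos le_rfl (by simp)
  refine ⟨Real.exp (-((M + 1) / η)), Real.exp_pos _, fun x hx => ?_⟩
  have := h x y _ (Real.exp_pos _) (by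
    rw [Real.exp_le_one_iff]; have : 0 ≤ (M + 1) / η := by positivity
    linarith) hx.le
  rw [Real.log_exp, neg_neg] at this
  rw [Real.dist_eq]
  by_contra! hc
  have h2 : η * ((M + 1) / η) ≤ |f x - f y| * ((M + 1) / η) := by gcongr
  rw [mul_div_cancel₀ _ hη.ne'] at h2
  linarith

theorem LogComparable.add {M N : ℝ} {f g : X → ℝ} (hf : LogComparable M f)
    (hg : LogComparable N g) : LogComparable (M + N) (fun x => f x + g x) := by
  intro x y r hr hr1 hd
  have hl : 0 ≤ -Real.log r := by linarith [Real.log_nonpos hr.le hr1]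
  calc |f x + g x - (f y + g y)| * (-Real.log r)
      ≤ (|f x - f y| + |g x - g y|) * (-Real.log r) := by
        gcongr
        calc |f x + g x - (f y + g y)| = |(f x - f y) + (g x - g y)| := by ring_nf
          _ ≤ _ := abs_add_le _ _
    _ ≤ M + N := by
        rw [add_mul]; exact add_le_add (hf x y r hr hr1 hd) (hg x y r hr hr1 hd)

theorem LogComparable.neg {M : ℝ} {f : X → ℝ} (hf : LogComparable M f) :
    LogComparable M (fun x => -f x) := by
  intro x y r hr hr1 hd
  rw [neg_sub_neg, abs_sub_comm]
  exact hf x y r hr hr1 hd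

theorem LogComparable.mul {M N A B : ℝ} {f g : X → ℝ} (hf : LogComparable M f)
    (hg : LogComparable N g) (hfA : ∀ x, |f x| ≤ A) (hgB : ∀ x, |g x| ≤ B) :
    LogComparable (A * N + B * M) (fun x => f x * g x) := by
  intro x y r hr hr1 hd
  have hl : 0 ≤ -Real.log r := by linarith [Real.log_nonpos hr.le hr1]
  have h1 := hf x y r hr hr1 hd
  have h2 := hg x y r hr hr1 hd
  have hA : 0 ≤ A := (abs_nonneg _).trans (hfA x)
  have hB : 0 ≤ B := (abs_nonneg _).trans (hgB x)
  calc |f x * g x - f y * g y| * (-Real.log r)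
      ≤ (|f x| * |g x - g y| + |g y| * |f x - f y|) * (-Real.log r) := by
        gcongr
        calc |f x * g x - f y * g y| = |f x * (g x - g y) + g y * (f x - f y)| := by ring_nf
          _ ≤ _ := (abs_add_le _ _).trans (by rw [abs_mul, abs_mul])
    _ ≤ (A * |g x - g y| + B * |f x - f y|) * (-Real.log r) := by
        gcongr
        · exact hfA x
        · exact hgB y
    _ = A * (|g x - g y| * (-Real.log r)) + B * (|f x - f y| * (-Real.log r)) := by ring
    _ ≤ A * N + B * M := by gcongr

theorem LogComparable.mono {M N : ℝ} {f : X → ℝ} (hf : LogComparable M f) (h : M ≤ N) :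
    LogComparable N f := fun x y r hr hr1 hd => (hf x y r hr hr1 hd).trans h

/-- Log-Hölder continuity is assumed for reciprocals only; the identity `f x - f y = -(f x * f y *
(1 / f x - 1 / f y))` transfers it to a bounded `f`. -/
theorem LogComparable.of_one_div {M A : ℝ} {f : X → ℝ}
    (hf : LogComparable M (fun x => 1 / f x)) (hpos : ∀ x, 0 < f x) (hA : ∀ x, f x ≤ A) :
    LogComparable (A * A * M) f := by
  intro x y r hr hr1 hd
  have hl : 0 ≤ -Real.log r := by linarith [Real.log_nonpos hr.le hr1]
  have hx := hpos x
  have hy := hpos y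
  have h := hf x y r hr hr1 hd
  have hA0 : 0 ≤ A := hx.le.trans (hA x)
  have e : |f x - f y| = f x * f y * |1 / f x - 1 / f y| := by
    have : f x - f y = -(f x * f y * (1 / f x - 1 / f y)) := by field_simp; ring
    rw [this, abs_neg, abs_mul, abs_of_pos (mul_pos hx hy)]
  rw [e, mul_assoc]
  have h0 : 0 ≤ |1 / f x - 1 / f y| * (-Real.log r) := mul_nonneg (abs_nonneg _) hl
  exact mul_le_mul (mul_le_mul (hA x) (hA y) hy.le hA0) h h0 (mul_nonneg hA0 hA0)

/-- This is what log-Hölder continuity is for: in a power of `r` the exponent may be moved to any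
point within distance `r`, at the cost of a constant factor. -/
theorem LogComparable.rpow_le {M : ℝ} {f : X → ℝ} (hf : LogComparable M f) {x y : X} {r : ℝ}
    (hr : 0 < r) (hr1 : r ≤ 1) (hd : dist x y ≤ r) :
    r ^ f x ≤ Real.exp M * r ^ f y := by
  rw [Real.rpow_def_of_pos hr, Real.rpow_def_of_pos hr, ← Real.exp_add]
  apply Real.exp_le_exp.2
  have h := hf x y r hr hr1 hd
  have hl : 0 ≤ -Real.log r := by linarith [Real.log_nonpos hr.le hr1]
  have : (f y - f x) * (-Real.log r) ≤ |f x - f y| * (-Real.log r) := by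
    gcongr
    rw [abs_sub_comm]; exact le_abs_self _
  linarith

end LogComparable

/-! ### Scalar Hajłasz gradients: good points and chaining -/

section Pair

variable {X : Type u} [MetricSpace X] [MeasurableSpace X]

/-- A function `v` with a scalar Hajłasz gradient `H` of variable smoothness `ε`, valid on a set
`S` of full measure, on a bounded space with a lower measure bound at scales up to `R ≤ 1`; the
exponents satisfy two-sided bounds and log-Hölder bounds everywhere. -/
structure HajlaszPair (μ : Measure X) (b R D a A M K : ℝ) (Q p ε : X → ℝ) (S : Set X)
    (v H : X → ℝ) : Prop where
  dist_le : ∀ x y : X, dist x y ≤ D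
  measurableSet_ball : ∀ (x : X) (r : ℝ), MeasurableSet (Metric.ball x r)
  lower_regular : ∀ (x : X) (r : ℝ), 0 < r → r ≤ R →
    ENNReal.ofReal (b * r ^ Q x) ≤ μ (Metric.ball x r)
  Q_mem : ∀ x, Q x ∈ Icc a A
  p_mem : ∀ x, p x ∈ Icc a A
  ε_mem : ∀ x, ε x ∈ Icc a A
  Q_log : LogComparable M Q
  p_log : LogComparable M p
  ε_log : LogComparable M ε
  null : μ Sᶜ = 0
  nonneg : ∀ x, 0 ≤ H x
  le : ∀ x ∈ S, ∀ y ∈ S, |v x - v y| ≤ dist x y ^ ε x * H x + dist x y ^ ε y * H y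
  modular_le : ∫⁻ x, ENNReal.ofReal (H x ^ p x) ∂μ ≤ ENNReal.ofReal K

variable {b R D a A M K : ℝ}

/-- Chebyshev's inequality: if `H` were larger almost everywhere on the ball, `H ^ p` would exceed a
large multiple of `r ^ (-Q x)` on a set of measure at least `b * r ^ Q x`, and its integral would
exceed `K`. `T` is chosen before the space, so it is uniform. -/
theorem exists_good_point (hb : 0 < b) (hR1 : R ≤ 1) (ha : 0 < a) (hK : 0 < K) :
    ∃ T : ℝ, 1 ≤ T ∧ ∀ {X : Type u} [MetricSpace X] [MeasurableSpace X] {μ : Measure X}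
      {Q p ε : X → ℝ} {S : Set X} {v H : X → ℝ},
      HajlaszPair μ b R D a A M K Q p ε S v H → ∀ (x : X) (r : ℝ), 0 < r → r ≤ R →
      ∃ y ∈ S, dist x y < r ∧ H y ≤ T * r ^ (-(Q x / p x)) := by
  -- `c` is the loss from having `p y` rather than `p x` in the exponent of `r`.
  set c : ℝ := Real.exp (-(A / a * M)) with hc
  have hc0 : 0 < c := Real.exp_pos _
  -- This makes `T0 * (c * b) = 2 * K + c * b > K`. The root `1 / a` taken below is undone by the
  -- power `p y ≥ a`.
  set T0 : ℝ := 2 * K / (c * b) + 1 with hT0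
  have hT01 : 1 ≤ T0 := by
    have : 0 ≤ 2 * K / (c * b) := by positivity
    linarith
  refine ⟨T0 ^ (1 / a), Real.one_le_rpow hT01 (by positivity), ?_⟩
  intro X _ _ μ Q p ε S v H h x r hr hrR
  by_contra! hcon
  have hr1 : r ≤ 1 := hrR.trans hR1
  have hT : 1 ≤ T0 ^ (1 / a) := Real.one_le_rpow hT01 (by positivity)
  have hpx : 0 < p x := ha.trans_le (h.p_mem x).1
  have hM : 0 ≤ M := by simpa using h.p_log x x 1 one_pos le_rfl (by simp)
  have key : ∀ y ∈ S, y ∈ Metric.ball x r → T0 * c * r ^ (-Q x) ≤ H y ^ p y := by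
    intro y hy hyr
    rw [Metric.mem_ball'] at hyr
    have hH := hcon y hy hyr
    have hpy : 0 < p y := ha.trans_le (h.p_mem y).1
    have hQ0 : 0 < Q x := ha.trans_le (h.Q_mem x).1
    have h1 : T0 ≤ (T0 ^ (1 / a)) ^ p y := by
      rw [← Real.rpow_mul (by linarith)]
      calc T0 = T0 ^ (1 : ℝ) := (Real.rpow_one _).symm
        _ ≤ _ := by
          apply Real.rpow_le_rpow_of_exponent_le hT01
          rw [one_div, inv_mul_eq_div, one_le_div ha]
          exact (h.p_mem y).1
    have h2 : c * r ^ (-Q x) ≤ (r ^ (-(Q x / p x))) ^ p y := by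
      rw [← Real.rpow_mul hr.le, Real.rpow_def_of_pos hr, Real.rpow_def_of_pos hr, hc,
        ← Real.exp_add]
      apply Real.exp_le_exp.2
      have hlog := h.p_log x y r hr hr1 hyr.le
      have hl : 0 ≤ -Real.log r := by linarith [Real.log_nonpos hr.le hr1]
      have e : Real.log r * (-(Q x / p x) * p y) =
          Real.log r * -Q x - (Q x / p x) * ((p x - p y) * (-Real.log r)) := by
        field_simp; ring
      rw [e]
      have h3 : (p x - p y) * (-Real.log r) ≤ M :=
        (mul_le_mul_of_nonneg_right (le_abs_self _) hl).trans hlog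
      have h4 : (Q x / p x) * ((p x - p y) * (-Real.log r)) ≤ A / a * M := by
        calc _ ≤ (Q x / p x) * M := by gcongr
          _ ≤ A / a * M := by
            gcongr
            · exact hQ0.le.trans (h.Q_mem x).2
            · exact (h.Q_mem x).2
            · exact (h.p_mem x).1
      linarith
    calc T0 * c * r ^ (-Q x) = T0 * (c * r ^ (-Q x)) := by ring
      _ ≤ (T0 ^ (1 / a)) ^ p y * (r ^ (-(Q x / p x))) ^ p y := by gcongr
      _ = (T0 ^ (1 / a) * r ^ (-(Q x / p x))) ^ p y := by
        rw [Real.mul_rpow (by positivity) (by positivity)]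
      _ ≤ H y ^ p y := by gcongr
  have h5 : ENNReal.ofReal (T0 * c * r ^ (-Q x)) * μ (Metric.ball x r) ≤ ENNReal.ofReal K := by
    calc ENNReal.ofReal (T0 * c * r ^ (-Q x)) * μ (Metric.ball x r)
        = ∫⁻ _ in Metric.ball x r, ENNReal.ofReal (T0 * c * r ^ (-Q x)) ∂μ := by
          rw [setLIntegral_const]
      _ ≤ ∫⁻ y in Metric.ball x r, ENNReal.ofReal (H y ^ p y) ∂μ := by
          apply lintegral_mono_ae
          rw [ae_restrict_iff' (h.measurableSet_ball x r)]
          have : ∀ᵐ y ∂μ, y ∈ S := h.null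
          filter_upwards [this] with y hy hyr
          exact ENNReal.ofReal_le_ofReal (key y hy hyr)
      _ ≤ ∫⁻ y, ENNReal.ofReal (H y ^ p y) ∂μ := setLIntegral_le_lintegral _ _
      _ ≤ _ := h.modular_le
  have h6 : ENNReal.ofReal (T0 * c * r ^ (-Q x) * (b * r ^ Q x)) ≤ ENNReal.ofReal K := by
    rw [ENNReal.ofReal_mul (by positivity)]
    exact (mul_le_mul_right (h.lower_regular x r hr hrR) _).trans h5
  rw [ENNReal.ofReal_le_ofReal_iff hK.le] at h6
  have h7 : T0 * c * r ^ (-Q x) * (b * r ^ Q x) = T0 * (c * b) := by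
    rw [Real.rpow_neg hr.le]
    field_simp
  rw [h7, hT0, add_mul, div_mul_cancel₀ _ (by positivity)] at h6
  have : 0 < c * b := by positivity
  linarith

theorem HajlaszPair.dist_rpow_le {μ : Measure X} {Q p ε : X → ℝ} {S : Set X} {v H : X → ℝ}
    (h : HajlaszPair μ b R D a A M K Q p ε S v H) (ha : 0 < a) {x y z : X} {r : ℝ} (hr : 0 < r)
    (hr1 : r ≤ 1) (hxy : dist x y ≤ r) (hyz : dist y z ≤ 3 * r) :
    dist y z ^ ε y ≤ 3 ^ A * Real.exp M * r ^ ε x := by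
  have hε : 0 < ε y := ha.trans_le (h.ε_mem y).1
  calc dist y z ^ ε y ≤ (3 * r) ^ ε y := by gcongr
    _ = 3 ^ ε y * r ^ ε y := Real.mul_rpow (by norm_num) hr.le
    _ ≤ 3 ^ A * (Real.exp M * r ^ ε x) := by
        gcongr
        · norm_num
        · exact (h.ε_mem y).2
        · exact h.ε_log.rpow_le hr hr1 (by rwa [dist_comm])
    _ = _ := by ring

/-- Telescoping along good points at dyadic scales. -/
theorem exists_chain (hb : 0 < b) (hR1 : R ≤ 1) (ha : 0 < a) (hK : 0 < K) :
    ∃ C T : ℝ, 1 ≤ C ∧ 1 ≤ T ∧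
      ∀ {X : Type u} [MetricSpace X] [MeasurableSpace X] {μ : Measure X}
      {Q p ε : X → ℝ} {S : Set X} {v H : X → ℝ},
      HajlaszPair μ b R D a A M K Q p ε S v H → ∀ (x : X) (r : ℝ), 0 < r → r ≤ R →
      ∃ y ∈ S, dist x y < r ∧ H y ≤ T * r ^ (-(Q x / p x)) ∧
        (x ∈ S → ∀ J : ℕ, |v x - v y| ≤
          C * (∑ j ∈ Finset.range (J + 1), (r * (1 / 2) ^ j) ^ (ε x - Q x / p x) +
            (r * (1 / 2) ^ J) ^ ε x * H x)) := by
  obtain ⟨T, hT1, hT⟩ := exists_good_point (D := D) (A := A) (M := M) hb hR1 ha hK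
  set E : ℝ := 3 ^ A * Real.exp M with hE
  have hE0 : 0 < E := by positivity
  -- The three contributions to be covered are a step between consecutive scales, the good point in
  -- the last step, and `H x` itself; `2 ^ (A / a)` comes from good points at the halved scale.
  set C : ℝ := E * T * (1 + 2 ^ (A / a)) + E + 1 with hC
  have h2 : (0 : ℝ) < 2 ^ (A / a) := by positivity
  have hT0 : 0 < T := by linarith
  refine ⟨C, T, ?_, hT1, ?_⟩
  · have : 0 ≤ E * T * (1 + 2 ^ (A / a)) := by positivity
    linarith
  intro X _ _ μ Q p ε S v H h x r hr hrR
  have hrj : ∀ j : ℕ, 0 < r * (1 / 2 : ℝ) ^ j := fun j => by positivity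
  have hrjr : ∀ j : ℕ, r * (1 / 2 : ℝ) ^ j ≤ R := fun j =>
    (mul_le_of_le_one_right hr.le (pow_le_one₀ (by norm_num) (by norm_num))).trans hrR
  choose y hyS hyd hyH using fun j : ℕ => hT h x (r * (1 / 2 : ℝ) ^ j) (hrj j) (hrjr j)
  refine ⟨y 0, hyS 0, by simpa using hyd 0, by simpa using hyH 0, fun hx J => ?_⟩
  have hQp : Q x / p x ≤ A / a := by
    have := (h.Q_mem x).1
    have := (h.p_mem x).1
    have := (h.Q_mem x).2
    gcongr
    · linarith
  have hprod : ∀ t : ℝ, 0 < t → t ^ ε x * t ^ (-(Q x / p x)) = t ^ (ε x - Q x / p x) := by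
    intro t ht
    rw [← Real.rpow_add ht, sub_eq_add_neg]
  have hstep : ∀ j : ℕ, |v (y (j + 1)) - v (y j)| ≤
      E * T * (1 + 2 ^ (A / a)) * (r * (1 / 2) ^ j) ^ (ε x - Q x / p x) := by
    intro j
    set t : ℝ := r * (1 / 2 : ℝ) ^ j with ht
    have ht0 : 0 < t := hrj j
    have ht1 : t ≤ 1 := (hrjr j).trans hR1
    have htj : r * (1 / 2 : ℝ) ^ (j + 1) = t * 2⁻¹ := by rw [ht, pow_succ]; ring
    have d1 := hyd (j + 1)
    have d0 := hyd j
    have e1 := hyH (j + 1)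
    have e0 := hyH j
    rw [htj] at d1 e1
    rw [← ht] at d0 e0
    have d1' : dist x (y (j + 1)) ≤ t := by linarith
    have dd : dist (y (j + 1)) (y j) ≤ 3 * t := by
      linarith [dist_triangle_left (y (j + 1)) (y j) x]
    have b1 := h.dist_rpow_le ha ht0 ht1 d1' dd
    have b0 := h.dist_rpow_le ha ht0 ht1 d0.le (by rwa [dist_comm] : dist (y j) (y (j + 1)) ≤ _)
    rw [dist_comm] at b0
    have e1' : H (y (j + 1)) ≤ T * (2 ^ (A / a) * t ^ (-(Q x / p x))) := by
      refine e1.trans ?_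
      rw [Real.mul_rpow ht0.le (by norm_num), mul_comm (t ^ _)]
      gcongr
      rw [Real.inv_rpow (by norm_num), Real.rpow_neg (by norm_num), inv_inv]
      exact Real.rpow_le_rpow_of_exponent_le (by norm_num) hQp
    calc |v (y (j + 1)) - v (y j)| ≤ _ := h.le _ (hyS _) _ (hyS _)
      _ ≤ (E * t ^ ε x) * (T * (2 ^ (A / a) * t ^ (-(Q x / p x)))) +
          (E * t ^ ε x) * (T * t ^ (-(Q x / p x))) := by
          gcongr
          · exact h.nonneg _
          · exact h.nonneg _
      _ = E * T * (1 + 2 ^ (A / a)) * (t ^ ε x * t ^ (-(Q x / p x))) := by ring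
      _ = _ := by rw [hprod t ht0]
  have htel : ∀ J : ℕ, |v (y J) - v (y 0)| ≤ ∑ j ∈ Finset.range J,
      E * T * (1 + 2 ^ (A / a)) * (r * (1 / 2) ^ j) ^ (ε x - Q x / p x) := by
    intro J
    induction J with
    | zero => simp
    | succ J ih =>
      rw [Finset.sum_range_succ]
      have := abs_sub_le (v (y (J + 1))) (v (y J)) (v (y 0))
      linarith [hstep J]
  -- The point `x` need not be good, so `H x` survives with a small factor. The `J` steps plus this
  -- one account for `J + 1` summands.
  have hend : |v x - v (y J)| ≤ E * (r * (1 / 2) ^ J) ^ ε x * H x +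
      E * T * (r * (1 / 2) ^ J) ^ (ε x - Q x / p x) := by
    set t : ℝ := r * (1 / 2 : ℝ) ^ J with ht
    have ht0 : 0 < t := hrj J
    have ht1 : t ≤ 1 := (hrjr J).trans hR1
    have d0 := hyd J
    rw [← ht] at d0
    have b1 := h.dist_rpow_le ha ht0 ht1 (by simpa using ht0.le : dist x x ≤ t)
      (by linarith : dist x (y J) ≤ 3 * t)
    have b0 := h.dist_rpow_le ha ht0 ht1 d0.le
      (by rw [dist_comm]; linarith : dist (y J) x ≤ 3 * t)
    rw [dist_comm] at b0
    calc |v x - v (y J)| ≤ _ := h.le _ hx _ (hyS _)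
      _ ≤ (E * t ^ ε x) * H x + (E * t ^ ε x) * (T * t ^ (-(Q x / p x))) := by
          gcongr
          · exact h.nonneg _
          · exact h.nonneg _
          · exact hyH J
      _ = E * t ^ ε x * H x + E * T * (t ^ ε x * t ^ (-(Q x / p x))) := by ring
      _ = _ := by rw [hprod t ht0]
  have h3 := abs_sub_le (v x) (v (y J)) (v (y 0))
  have h4 := htel J
  rw [← Finset.mul_sum] at h4
  rw [Finset.sum_range_succ, mul_add, mul_add]
  set s : ℝ := ∑ j ∈ Finset.range J, (r * (1 / 2) ^ j) ^ (ε x - Q x / p x) with hs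
  have hs0 : 0 ≤ s := Finset.sum_nonneg fun j _ => (Real.rpow_pos_of_pos (hrj j) _).le
  have c1 : E * T * (1 + 2 ^ (A / a)) ≤ C := by linarith
  have c2 : E * T ≤ C := by
    have : E * T * 1 ≤ E * T * (1 + 2 ^ (A / a)) := by gcongr; linarith
    linarith
  have c3 : E ≤ C := by
    have : 0 ≤ E * T * (1 + 2 ^ (A / a)) := by positivity
    linarith
  have k1 := mul_le_mul_of_nonneg_right c1 hs0
  have k2 := mul_le_mul_of_nonneg_right c2
    (Real.rpow_pos_of_pos (hrj J) (ε x - Q x / p x)).le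
  have k3 := mul_le_mul_of_nonneg_right c3
    (mul_nonneg (Real.rpow_pos_of_pos (hrj J) (ε x)).le (h.nonneg x))
  rw [← mul_assoc] at k3
  linarith

end Pair

/-! ### Pointwise estimates in the three regimes -/

section PairEstimates

variable {b R D a A M K κ : ℝ}

/-- In a bounded space the powers of the distance are bounded, so `v` oscillates boundedly on
sublevel sets of `H`. Hence the ends of chains from different points are comparable. -/
theorem HajlaszPair.abs_sub_le_of_sublevel {X : Type u} [MetricSpace X] [MeasurableSpace X]
    {μ : Measure X} {Q p ε : X → ℝ} {S : Set X} {v H : X → ℝ}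
    (h : HajlaszPair μ b R D a A M K Q p ε S v H) (ha : 0 < a) {y z : X} {t : ℝ}
    (hy : y ∈ S) (hz : z ∈ S) (hHy : H y ≤ t) (hHz : H z ≤ t) :
    |v y - v z| ≤ 2 * (max D 1) ^ A * t := by
  have ht : 0 ≤ t := (h.nonneg y).trans hHy
  have hd : ∀ w : X, dist y z ^ ε w ≤ (max D 1) ^ A := fun w => by
    have := ha.trans_le (h.ε_mem w).1
    calc dist y z ^ ε w ≤ (max D 1) ^ ε w := by
          gcongr
          exact (h.dist_le y z).trans (le_max_left _ _)
      _ ≤ _ := Real.rpow_le_rpow_of_exponent_le (le_max_right _ _) (h.ε_mem w).2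
  have h0 : (0 : ℝ) ≤ (max D 1) ^ A := by positivity
  calc |v y - v z| ≤ _ := h.le _ hy _ hz
    _ ≤ (max D 1) ^ A * t + (max D 1) ^ A * t := by
        gcongr
        · exact h.nonneg _
        · exact hd _
        · exact h.nonneg _
        · exact hd _
    _ = _ := by ring

theorem HajlaszPair.div_le {X : Type u} [MetricSpace X] [MeasurableSpace X]
    {μ : Measure X} {Q p ε : X → ℝ} {S : Set X} {v H : X → ℝ}
    (h : HajlaszPair μ b R D a A M K Q p ε S v H) (ha : 0 < a) (x : X) :
    Q x / p x ≤ A / a := by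
  have := (h.Q_mem x).1
  have := (h.p_mem x).1
  have := (h.Q_mem x).2
  gcongr
  · linarith

theorem HajlaszPair.rpow_neg_div_le {X : Type u} [MetricSpace X] [MeasurableSpace X]
    {μ : Measure X} {Q p ε : X → ℝ} {S : Set X} {v H : X → ℝ}
    (h : HajlaszPair μ b R D a A M K Q p ε S v H) (ha : 0 < a) (hR : 0 < R) (hR1 : R ≤ 1)
    (x : X) : R ^ (-(Q x / p x)) ≤ R ^ (-(A / a)) :=
  Real.rpow_le_rpow_of_exponent_ge hR hR1 (neg_le_neg (h.div_le ha x))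

/-- The chain from `x` at the top scale `R` ends at a point where `H` is bounded uniformly in `x`,
so that end may be exchanged for one reference point `y` serving all `x`. -/
theorem exists_chain_to_sublevel (hb : 0 < b) (hR : 0 < R) (hR1 : R ≤ 1) (ha : 0 < a)
    (hK : 0 < K) {T : ℝ} (hT : 0 ≤ T) :
    ∃ C : ℝ, 1 ≤ C ∧
      ∀ {X : Type u} [MetricSpace X] [MeasurableSpace X] {μ : Measure X}
      {Q p ε : X → ℝ} {S : Set X} {v H : X → ℝ},
      HajlaszPair μ b R D a A M K Q p ε S v H → ∀ x ∈ S, ∀ y ∈ S, H y ≤ T → ∀ J : ℕ,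
        |v x - v y| ≤
          C * (1 + ∑ j ∈ Finset.range (J + 1), (R * (1 / 2) ^ j) ^ (ε x - Q x / p x) +
            (R * (1 / 2) ^ J) ^ ε x * H x) := by
  obtain ⟨C, T1, hC, hT1, hchain⟩ :=
    exists_chain.{u} (D := D) (A := A) (M := M) hb hR1 ha hK
  set T2 : ℝ := max T (T1 * R ^ (-(A / a))) with hT2
  have hT20 : 0 ≤ T2 := hT.trans (le_max_left _ _)
  have hDT : 0 ≤ 2 * (max D 1) ^ A * T2 := by positivity
  refine ⟨C + 2 * (max D 1) ^ A * T2, by linarith, ?_⟩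
  intro X _ _ μ Q p ε S v H h x hx y hy hHy J
  obtain ⟨z, hz, -, hHz, hzJ⟩ := hchain h x R hR le_rfl
  have h1 := hzJ hx J
  have h2 := h.abs_sub_le_of_sublevel ha hz hy (t := T2)
    ((hHz.trans (mul_le_mul_of_nonneg_left (h.rpow_neg_div_le ha hR hR1 x) (by linarith))).trans
      (le_max_right _ _)) (hHy.trans (le_max_left _ _))
  have h3 := abs_sub_le (v x) (v z) (v y)
  set s : ℝ := ∑ j ∈ Finset.range (J + 1), (R * (1 / 2) ^ j) ^ (ε x - Q x / p x)
  have hs : 0 ≤ s := Finset.sum_nonneg fun j _ => by positivity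
  have hw : 0 ≤ (R * (1 / 2) ^ J) ^ ε x * H x := mul_nonneg (by positivity) (h.nonneg x)
  nlinarith [mul_nonneg hDT hs, mul_nonneg hDT hw]

/-- The subcritical estimate. -/
theorem exists_abs_sub_le_rpow (hb : 0 < b) (hR : 0 < R) (hR1 : R ≤ 1) (ha : 0 < a)
    (hA : 0 < A) (hK : 0 < K) (hκ : 0 < κ) {T : ℝ} (hT : 0 ≤ T) :
    ∃ C : ℝ, 1 ≤ C ∧
      ∀ {X : Type u} [MetricSpace X] [MeasurableSpace X] {μ : Measure X}
      {Q p ε : X → ℝ} {S : Set X} {v H : X → ℝ},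
      HajlaszPair μ b R D a A M K Q p ε S v H → (∀ x, κ ≤ Q x - ε x * p x) →
      ∀ x ∈ S, ∀ y ∈ S, H y ≤ T →
        |v x - v y| ≤ C * (max 1 (H x)) ^ (1 - ε x * p x / Q x) := by
  obtain ⟨C, hC, hchain⟩ :=
    exists_chain_to_sublevel.{u} (D := D) (A := A) (M := M) hb hR hR1 ha hK hT
  set q : ℝ := (1 / 2) ^ (κ / A) with hq
  have hq1 : q < 1 := Real.rpow_lt_one (by norm_num) (by norm_num) (by positivity)
  have hq0 : 0 < q := by positivity
  set G : ℝ := 1 / (1 - q) with hG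
  have hG0 : 0 < G := by rw [hG]; apply div_pos one_pos; linarith
  have hGq : G * q + 1 = G := by
    rw [hG]
    have : 1 - q ≠ 0 := by linarith
    field_simp
    ring
  have hRA : (0 : ℝ) < R ^ (-(A / a)) := by positivity
  have h2A : (0 : ℝ) < 2 ^ A := by positivity
  refine ⟨C * (1 + G * R ^ (-(A / a)) + 2 ^ A), ?_, ?_⟩
  · nlinarith [mul_pos hG0 hRA]
  intro X _ _ μ Q p ε S v H h hgap x hx y hy hHy
  have hp : 0 < p x := ha.trans_le (h.p_mem x).1
  have hQ : 0 < Q x := ha.trans_le (h.Q_mem x).1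
  have hε : 0 < ε x := ha.trans_le (h.ε_mem x).1
  set β : ℝ := ε x - Q x / p x with hβ
  set t : ℝ := max 1 (H x) with ht
  have ht1 : 1 ≤ t := le_max_left _ _
  have ht0 : 0 < t := by linarith
  -- The scale at which `τ ^ β` and `τ ^ ε x * t` agree: both equal `t ^ (1 - ε x * p x / Q x)`. `J`
  -- is its dyadic index.
  set τ : ℝ := t ^ (-(p x / Q x)) with hτ
  have hτ0 : 0 < τ := by positivity
  have hτ1 : τ ≤ 1 := Real.rpow_le_one_of_one_le_of_nonpos ht1 (by
    have : 0 < p x / Q x := by positivity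
    linarith)
  have hβκ : κ / A ≤ -β := by
    have e : -β = (Q x - ε x * p x) / p x := by rw [hβ]; field_simp; ring
    rw [e]
    have := hgap x
    have := (h.p_mem x).2
    gcongr
    · linarith
  have hκA : 0 < κ / A := by positivity
  obtain ⟨J, hJ1, hJ2⟩ := exists_nat_pow_near_of_lt_one hτ0 hτ1
    (by norm_num : (0 : ℝ) < 1 / 2) (by norm_num)
  -- As `β ≤ -κ / A`, the summands grow at least by the factor `1 / q`, so the last one dominates;
  -- `G` is the fixed point of `G * q + 1 = G`, which closes the induction.
  have hsum : ∀ n : ℕ, ∑ j ∈ Finset.range (n + 1), (R * (1 / 2) ^ j) ^ β ≤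
      G * (R * (1 / 2) ^ n) ^ β := by
    intro n
    induction n with
    | zero =>
      simp only [zero_add, Finset.range_one, Finset.sum_singleton]
      apply le_mul_of_one_le_left (by positivity)
      nlinarith
    | succ n ih =>
      rw [Finset.sum_range_succ]
      have e : (R * (1 / 2 : ℝ) ^ n) ^ β ≤ q * (R * (1 / 2) ^ (n + 1)) ^ β := by
        rw [pow_succ, ← mul_assoc,
          Real.mul_rpow (x := R * (1 / 2) ^ n) (y := 1 / 2) (by positivity) (by norm_num)]
        have : (1 : ℝ) ≤ q * (1 / 2) ^ β := by
          rw [hq, ← Real.rpow_add (by norm_num)]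
          apply Real.one_le_rpow_of_pos_of_le_one_of_nonpos (by norm_num) (by norm_num)
          linarith
        have h0 : 0 ≤ (R * (1 / 2 : ℝ) ^ n) ^ β := by positivity
        nlinarith
      calc _ ≤ G * (R * (1 / 2) ^ n) ^ β + (R * (1 / 2) ^ (n + 1)) ^ β := by gcongr
        _ ≤ G * (q * (R * (1 / 2) ^ (n + 1)) ^ β) + (R * (1 / 2) ^ (n + 1)) ^ β := by gcongr
        _ = (G * q + 1) * (R * (1 / 2) ^ (n + 1)) ^ β := by ring
        _ = _ := by rw [hGq]
  have hθ : τ ^ β = t ^ (1 - ε x * p x / Q x) := by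
    rw [hτ, ← Real.rpow_mul ht0.le, hβ]
    congr 1
    field_simp
    ring
  have hθ0 : 0 ≤ 1 - ε x * p x / Q x := by
    rw [sub_nonneg, div_le_one hQ]
    linarith [hgap x]
  have b1 : (1 : ℝ) ≤ t ^ (1 - ε x * p x / Q x) := Real.one_le_rpow ht1 hθ0
  have b2 : (R * (1 / 2 : ℝ) ^ J) ^ β ≤ R ^ (-(A / a)) * t ^ (1 - ε x * p x / Q x) := by
    rw [Real.mul_rpow hR.le (by positivity), ← hθ]
    gcongr ?_ * ?_
    · apply Real.rpow_le_rpow_of_exponent_ge hR hR1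
      linarith [h.div_le ha x]
    · exact Real.rpow_le_rpow_of_nonpos hτ0 hJ2 (by linarith)
  have b3 : (R * (1 / 2 : ℝ) ^ J) ^ ε x * H x ≤ 2 ^ A * t ^ (1 - ε x * p x / Q x) := by
    have hle : R * (1 / 2 : ℝ) ^ J ≤ 2 * τ := by
      rw [pow_succ] at hJ1
      have : R * (1 / 2 : ℝ) ^ J ≤ 1 * (1 / 2) ^ J := by gcongr
      linarith
    calc (R * (1 / 2 : ℝ) ^ J) ^ ε x * H x ≤ (2 * τ) ^ ε x * t := by
          gcongr
          · exact h.nonneg x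
          · exact le_max_right _ _
      _ = 2 ^ ε x * (τ ^ ε x * t) := by
          rw [Real.mul_rpow (by norm_num) hτ0.le]; ring
      _ ≤ 2 ^ A * (τ ^ ε x * t) := by
          gcongr
          · norm_num
          · exact (h.ε_mem x).2
      _ = _ := by
          congr 1
          rw [hτ, ← Real.rpow_mul ht0.le]
          nth_rewrite 2 [← Real.rpow_one t]
          rw [← Real.rpow_add ht0]
          congr 1
          field_simp
          ring
  have h1 := hchain h x hx y hy hHy J
  have h2 := hsum J
  have h3 : G * (R * (1 / 2 : ℝ) ^ J) ^ β ≤ G * (R ^ (-(A / a)) * t ^ (1 - ε x * p x / Q x)) := by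
    gcongr
  calc _ ≤ _ := h1
    _ ≤ C * (t ^ (1 - ε x * p x / Q x) + G * (R ^ (-(A / a)) * t ^ (1 - ε x * p x / Q x)) +
        2 ^ A * t ^ (1 - ε x * p x / Q x)) := by
        gcongr
        exact h2.trans h3
    _ = _ := by ring

/-- The critical estimate. -/
theorem exists_abs_sub_le_log (hb : 0 < b) (hR : 0 < R) (hR1 : R ≤ 1) (ha : 0 < a)
    (hK : 0 < K) {T : ℝ} (hT : 0 ≤ T) :
    ∃ C : ℝ, 1 ≤ C ∧
      ∀ {X : Type u} [MetricSpace X] [MeasurableSpace X] {μ : Measure X}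
      {Q p ε : X → ℝ} {S : Set X} {v H : X → ℝ},
      HajlaszPair μ b R D a A M K Q p ε S v H → (∀ x, ε x * p x = Q x) →
      ∀ x ∈ S, ∀ y ∈ S, H y ≤ T →
        |v x - v y| ≤ C * (1 + Real.log (max 1 (H x))) := by
  obtain ⟨C, hC, hchain⟩ :=
    exists_chain_to_sublevel.{u} (D := D) (A := A) (M := M) hb hR hR1 ha hK hT
  have hl2 : 0 < Real.log 2 := Real.log_pos (by norm_num)
  have hal : 0 < a * Real.log 2 := by positivity
  refine ⟨C * (4 + 1 / (a * Real.log 2)), ?_, ?_⟩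
  · have : 0 < 1 / (a * Real.log 2) := by positivity
    nlinarith
  intro X _ _ μ Q p ε S v H h hcrit x hx y hy hHy
  have hp : 0 < p x := ha.trans_le (h.p_mem x).1
  have hβ : ε x - Q x / p x = 0 := by
    rw [← hcrit x]; field_simp; ring
  set t : ℝ := max 1 (H x) with ht
  have ht1 : 1 ≤ t := le_max_left _ _
  have ht0 : 0 < t := by linarith
  have hlt : 0 ≤ Real.log t := Real.log_nonneg ht1
  -- The least `J` with `((1 / 2) ^ J) ^ a * t ≤ 1`; every summand of the chain equals 1 here, so
  -- `J` itself is the bound.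
  set J : ℕ := ⌈Real.log t / (a * Real.log 2)⌉₊ with hJ
  have hJ1 : Real.log t / (a * Real.log 2) ≤ J := Nat.le_ceil _
  have hJ2 : (J : ℝ) < Real.log t / (a * Real.log 2) + 1 := Nat.ceil_lt_add_one (by positivity)
  have hJ3 : Real.log t ≤ J * (a * Real.log 2) := (div_le_iff₀ hal).1 hJ1
  have b3 : (R * (1 / 2 : ℝ) ^ J) ^ ε x * H x ≤ 1 := by
    have hle : R * (1 / 2 : ℝ) ^ J ≤ (1 / 2) ^ J := mul_le_of_le_one_left (by positivity) hR1
    have hε := (h.ε_mem x).1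
    have hε0 : 0 < ε x := ha.trans_le hε
    calc (R * (1 / 2 : ℝ) ^ J) ^ ε x * H x ≤ ((1 / 2) ^ J) ^ ε x * t := by
          gcongr
          · exact h.nonneg x
          · exact le_max_right _ _
      _ ≤ ((1 / 2) ^ J) ^ a * t := by
          gcongr ?_ * _
          exact Real.rpow_le_rpow_of_exponent_ge (by positivity)
            (pow_le_one₀ (by norm_num) (by norm_num)) hε
      _ ≤ 1 := by
          rw [← Real.exp_log (show (0 : ℝ) < ((1 / 2) ^ J) ^ a * t by positivity),
            Real.exp_le_one_iff, Real.log_mul (by positivity) ht0.ne',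
            Real.log_rpow (by positivity), Real.log_pow, one_div, Real.log_inv]
          linarith
  have h1 := hchain h x hx y hy hHy J
  simp only [hβ, Real.rpow_zero, Finset.sum_const, Finset.card_range, nsmul_eq_mul,
    mul_one] at h1
  push_cast at h1
  calc _ ≤ _ := h1
    _ ≤ C * (1 + ((Real.log t / (a * Real.log 2) + 1) + 1) + 1) := by gcongr
    _ ≤ C * ((4 + 1 / (a * Real.log 2)) * (1 + Real.log t)) := by
        gcongr
        have : 0 < 1 / (a * Real.log 2) := by positivity
        rw [div_eq_mul_one_div]
        nlinarith
    _ = _ := by ring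

/-- The exponent `ε x - Q x / p x` is at least `κ / A > 0`, so the sum over scales is a convergent
geometric series. Since `H x` is finite, its term vanishes as `J → ∞`, leaving a bound free of `H
x`. -/
theorem exists_supercritical_chain (hb : 0 < b) (hR1 : R ≤ 1) (ha : 0 < a)
    (hA : 0 < A) (hK : 0 < K) (hκ : 0 < κ) :
    ∃ C T : ℝ, 1 ≤ C ∧ 1 ≤ T ∧
      ∀ {X : Type u} [MetricSpace X] [MeasurableSpace X] {μ : Measure X}
      {Q p ε : X → ℝ} {S : Set X} {v H : X → ℝ},
      HajlaszPair μ b R D a A M K Q p ε S v H → (∀ x, κ ≤ ε x * p x - Q x) →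
      ∀ x ∈ S, ∀ r, 0 < r → r ≤ R →
      ∃ y ∈ S, dist x y < r ∧ H y ≤ T * r ^ (-(Q x / p x)) ∧
        |v x - v y| ≤ C * r ^ (ε x - Q x / p x) := by
  obtain ⟨C, T, hC, hT, hchain⟩ := exists_chain.{u} (D := D) (A := A) (M := M) hb hR1 ha hK
  set q : ℝ := (1 / 2) ^ (κ / A) with hq
  have hq1 : q < 1 := Real.rpow_lt_one (by norm_num) (by norm_num) (by positivity)
  have hq0 : 0 < q := by positivity
  have hG : 1 ≤ (1 - q)⁻¹ := (one_le_inv₀ (by linarith)).2 (by linarith)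
  refine ⟨C * (1 - q)⁻¹, T, by nlinarith, hT, ?_⟩
  intro X _ _ μ Q p ε S v H h hgap x hx r hr hrR
  obtain ⟨y, hy, hxy, hHy, hv⟩ := hchain h x r hr hrR
  refine ⟨y, hy, hxy, hHy, ?_⟩
  have hp : 0 < p x := ha.trans_le (h.p_mem x).1
  have hε : 0 < ε x := ha.trans_le (h.ε_mem x).1
  set β : ℝ := ε x - Q x / p x with hβ
  have hβκ : κ / A ≤ β := by
    have e : β = (ε x * p x - Q x) / p x := by rw [hβ]; field_simp
    rw [e]
    have := hgap x
    have := (h.p_mem x).2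
    gcongr
    · linarith
  have hsum : ∀ J : ℕ, ∑ j ∈ Finset.range (J + 1), (r * (1 / 2) ^ j) ^ β ≤
      r ^ β * (1 - q)⁻¹ := by
    intro J
    calc ∑ j ∈ Finset.range (J + 1), (r * (1 / 2) ^ j) ^ β
        ≤ ∑ j ∈ Finset.range (J + 1), r ^ β * q ^ j := by
          gcongr with j _
          rw [Real.mul_rpow hr.le (by positivity)]
          gcongr
          rw [← Real.rpow_natCast, ← Real.rpow_mul (by norm_num), mul_comm,
            Real.rpow_mul (by norm_num), Real.rpow_natCast]
          gcongr
          exact Real.rpow_le_rpow_of_exponent_ge (by norm_num) (by norm_num) hβκ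
      _ = r ^ β * ∑ j ∈ Finset.range (J + 1), q ^ j := by rw [Finset.mul_sum]
      _ ≤ r ^ β * (1 - q)⁻¹ := by
          gcongr
          rw [← tsum_geometric_of_lt_one hq0.le hq1]
          exact (summable_geometric_of_lt_one hq0.le hq1).sum_le_tsum _ fun i _ => by positivity
  have hlim : Filter.Tendsto (fun J : ℕ => C * (r ^ β * (1 - q)⁻¹ +
      (r * (1 / 2 : ℝ) ^ J) ^ ε x * H x)) Filter.atTop
      (nhds (C * (r ^ β * (1 - q)⁻¹ + (r * 0) ^ ε x * H x))) := by
    have h0 : Filter.Tendsto (fun J : ℕ => (1 / 2 : ℝ) ^ J) Filter.atTop (nhds 0) :=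
      tendsto_pow_atTop_nhds_zero_of_lt_one (by norm_num) (by norm_num)
    have h1 : Filter.Tendsto (fun J : ℕ => (r * (1 / 2 : ℝ) ^ J) ^ ε x) Filter.atTop
        (nhds ((r * 0) ^ ε x)) := (h0.const_mul r).rpow_const (Or.inr hε.le)
    exact ((h1.mul_const _).const_add _).const_mul _
  rw [mul_zero, Real.zero_rpow hε.ne', zero_mul, add_zero] at hlim
  have := ge_of_tendsto' hlim fun J => (hv hx J).trans (by gcongr; exact hsum J)
  linarith

/-- The supercritical estimates: boundedness and Hölder continuity. -/
theorem exists_abs_sub_le_dist_rpow (hb : 0 < b) (hR : 0 < R) (hR1 : R ≤ 1) (ha : 0 < a)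
    (hA : 0 < A) (hK : 0 < K) (hκ : 0 < κ) :
    ∃ C : ℝ, 1 ≤ C ∧
      ∀ {X : Type u} [MetricSpace X] [MeasurableSpace X] {μ : Measure X}
      {Q p ε : X → ℝ} {S : Set X} {v H : X → ℝ},
      HajlaszPair μ b R D a A M K Q p ε S v H → (∀ x, κ ≤ ε x * p x - Q x) →
      LogComparable M (fun x => ε x - Q x / p x) →
      ∀ x ∈ S, ∀ y ∈ S, |v x - v y| ≤ C ∧
        |v x - v y| ≤ C * dist x y ^ (ε x - Q x / p x) := by
  obtain ⟨C, T, hC, hT, hchain⟩ :=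
    exists_supercritical_chain.{u} (D := D) (A := A) (M := M) hb hR1 ha hA hK hκ
  set E : ℝ := 3 ^ A * Real.exp M with hE
  have hE0 : 0 < E := by positivity
  set C1 : ℝ := 2 * C + 2 * (max D 1) ^ A * (T * R ^ (-(A / a))) with hC1
  set C2 : ℝ := (C + E * T) * (1 + Real.exp M) with hC2
  have hRA : 1 ≤ R ^ (-A) := Real.one_le_rpow_of_pos_of_le_one_of_nonpos hR hR1 (by linarith)
  have hC10 : 1 ≤ C1 := by
    have : 0 ≤ 2 * (max D 1) ^ A * (T * R ^ (-(A / a))) := by positivity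
    linarith
  have hC20 : 0 ≤ C2 := by positivity
  have hC1R : C1 ≤ C1 * R ^ (-A) := le_mul_of_one_le_right (by linarith) hRA
  refine ⟨C1 * R ^ (-A) + C2, by linarith, ?_⟩
  intro X _ _ μ Q p ε S v H h hgap hα x hx y hy
  have hαpos : ∀ z, 0 < ε z - Q z / p z := fun z => by
    have hp : 0 < p z := ha.trans_le (h.p_mem z).1
    rw [sub_pos, div_lt_iff₀ hp]
    linarith [hgap z]
  have hαA : ∀ z, ε z - Q z / p z ≤ A := fun z => by
    have hp : 0 < p z := ha.trans_le (h.p_mem z).1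
    have hQ : 0 < Q z := ha.trans_le (h.Q_mem z).1
    have : 0 < Q z / p z := by positivity
    linarith [(h.ε_mem z).2]
  have hbdd : |v x - v y| ≤ C1 := by
    obtain ⟨x', hx', -, hHx, hvx⟩ := hchain h hgap x hx R hR le_rfl
    obtain ⟨y', hy', -, hHy, hvy⟩ := hchain h hgap y hy R hR le_rfl
    have hle : ∀ z, T * R ^ (-(Q z / p z)) ≤ T * R ^ (-(A / a)) := fun z =>
      mul_le_mul_of_nonneg_left (h.rpow_neg_div_le ha hR hR1 z) (by linarith)
    have h1 := h.abs_sub_le_of_sublevel ha hx' hy' (hHx.trans (hle x)) (hHy.trans (hle y))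
    have hle1 : ∀ z, C * R ^ (ε z - Q z / p z) ≤ C := fun z =>
      mul_le_of_le_one_right (by linarith) (Real.rpow_le_one hR.le hR1 (hαpos z).le)
    have h2 := abs_sub_le (v x) (v x') (v y)
    have h3 := abs_sub_le (v x') (v y') (v y)
    rw [abs_sub_comm] at hvy
    linarith [hle1 x, hle1 y]
  refine ⟨by linarith, ?_⟩
  rcases eq_or_ne x y with rfl | hxy
  · rw [sub_self, abs_zero]; positivity
  have hd : 0 < dist x y := dist_pos.2 hxy
  rcases le_or_gt (dist x y) R with hdR | hdR
  -- Chains at scale `dist x y` from both `x` and `y` end at good points at most `3 * r` apart.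
  -- Larger distances are covered by boundedness and the factor `R ^ (-A)`.
  · set r : ℝ := dist x y with hr
    have hr1 : r ≤ 1 := hdR.trans hR1
    obtain ⟨x', hx', hxx, hHx, hvx⟩ := hchain h hgap x hx r hd hdR
    obtain ⟨y', hy', hyy, hHy, hvy⟩ := hchain h hgap y hy r hd hdR
    have hdd : dist x' y' ≤ 3 * r := by
      have := dist_triangle4 x' x y y'
      rw [dist_comm x' x] at this
      linarith
    have b1 := h.dist_rpow_le ha hd hr1 hxx.le hdd
    have b2 := h.dist_rpow_le ha hd hr1 hyy.le (by rwa [dist_comm] : dist y' x' ≤ _)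
    rw [dist_comm] at b2
    have hprod : ∀ z, r ^ ε z * r ^ (-(Q z / p z)) = r ^ (ε z - Q z / p z) := fun z => by
      rw [← Real.rpow_add hd, sub_eq_add_neg]
    have h1 : |v x' - v y'| ≤ E * T * r ^ (ε x - Q x / p x) + E * T * r ^ (ε y - Q y / p y) := by
      calc |v x' - v y'| ≤ _ := h.le _ hx' _ hy'
        _ ≤ E * r ^ ε x * (T * r ^ (-(Q x / p x))) + E * r ^ ε y * (T * r ^ (-(Q y / p y))) := by
          gcongr
          · exact h.nonneg _
          · exact h.nonneg _
        _ = E * T * (r ^ ε x * r ^ (-(Q x / p x))) + E * T * (r ^ ε y * r ^ (-(Q y / p y))) := by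
          ring
        _ = _ := by rw [hprod, hprod]
    have h2 := abs_sub_le (v x) (v x') (v y)
    have h3 := abs_sub_le (v x') (v y') (v y)
    rw [abs_sub_comm] at hvy
    have h4 : r ^ (ε y - Q y / p y) ≤ Real.exp M * r ^ (ε x - Q x / p x) :=
      hα.rpow_le hd hr1 (by rw [dist_comm])
    have h5 : (C + E * T) * r ^ (ε y - Q y / p y) ≤
        (C + E * T) * (Real.exp M * r ^ (ε x - Q x / p x)) := by gcongr
    have h6 : 0 ≤ C1 * R ^ (-A) * r ^ (ε x - Q x / p x) := by positivity
    have h7 : (C1 * R ^ (-A) + C2) * r ^ (ε x - Q x / p x) =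
        C1 * R ^ (-A) * r ^ (ε x - Q x / p x) + (C * r ^ (ε x - Q x / p x) +
        E * T * r ^ (ε x - Q x / p x) + (C + E * T) * (Real.exp M * r ^ (ε x - Q x / p x))) := by
      rw [hC2]; ring
    rw [h7]
    have h8 : (C + E * T) * r ^ (ε y - Q y / p y) =
      C * r ^ (ε y - Q y / p y) + E * T * r ^ (ε y - Q y / p y) := by ring
    linarith
  · have h1 : 1 ≤ R ^ (-A) * dist x y ^ (ε x - Q x / p x) := by
      calc (1 : ℝ) = R ^ (-A) * R ^ A := by rw [← Real.rpow_add hR]; simp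
        _ ≤ R ^ (-A) * R ^ (ε x - Q x / p x) := by
          exact mul_le_mul_of_nonneg_left
            (Real.rpow_le_rpow_of_exponent_ge hR hR1 (hαA x)) (by positivity)
        _ ≤ _ := by
          gcongr
          exact (hαpos x).le
    have h2 : 0 ≤ C2 * dist x y ^ (ε x - Q x / p x) := by positivity
    calc |v x - v y| ≤ C1 * 1 := by linarith
      _ ≤ C1 * (R ^ (-A) * dist x y ^ (ε x - Q x / p x)) := by gcongr
      _ ≤ _ := by rw [add_mul, ← mul_assoc]; linarith

end PairEstimates

/-! ### Trading smoothness for summability over scales -/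

section SupGradient

variable {X : Type u} {A κ : ℝ}

/-- A scalar gradient dominating a vector gradient whose indices are at least `-m`. -/
noncomputable def supGradient (A κ : ℝ) (m : ℕ) (g : ℤ → X → ℝ≥0∞) (x : X) : ℝ≥0∞ :=
  ⨆ i : ℕ, ENNReal.ofReal (((2 : ℝ) ^ m) ^ A * ((1 / 2 : ℝ) ^ κ) ^ i) * g (i - m) x

/-- Split `d ^ σ = d ^ τ * d ^ (σ - τ)`. Since `d < 2 ^ (m - i)` and `κ ≤ σ - τ ≤ A`, the second
factor is at most the weight of index `i` in the supremum. -/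
theorem ofReal_rpow_mul_le_supGradient (hκ : 0 < κ) {m i : ℕ} {d σ τ : ℝ}
    (hd : 0 < d) (hdm : d < 2 ^ m * (1 / 2) ^ i) (hτ : 0 ≤ τ) (hσ : σ ≤ A) (hστ : κ ≤ σ - τ)
    (g : ℤ → X → ℝ≥0∞) (x : X) :
    ENNReal.ofReal (d ^ σ) * g (i - m) x ≤ ENNReal.ofReal (d ^ τ) * supGradient A κ m g x := by
  have h1 : d ^ (σ - τ) ≤ ((2 : ℝ) ^ m) ^ A * ((1 / 2 : ℝ) ^ κ) ^ i := by
    calc d ^ (σ - τ) ≤ (2 ^ m * (1 / 2) ^ i) ^ (σ - τ) := by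
          gcongr
          linarith
      _ = (2 ^ m) ^ (σ - τ) * ((1 / 2) ^ i) ^ (σ - τ) :=
          Real.mul_rpow (by positivity) (by positivity)
      _ ≤ (2 ^ m) ^ A * ((1 / 2) ^ i) ^ κ := by
          gcongr ?_ * ?_
          · exact Real.rpow_le_rpow_of_exponent_le (one_le_pow₀ (by norm_num)) (by linarith)
          · exact Real.rpow_le_rpow_of_exponent_ge (by positivity)
              (pow_le_one₀ (by norm_num) (by norm_num)) hστ
      _ = _ := by
          congr 1
          rw [← Real.rpow_natCast, ← Real.rpow_natCast, ← Real.rpow_mul (by norm_num),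
            ← Real.rpow_mul (by norm_num), mul_comm]
  have e : d ^ σ = d ^ τ * d ^ (σ - τ) := by rw [← Real.rpow_add hd]; congr 1; ring
  rw [e, ENNReal.ofReal_mul (by positivity), mul_assoc]
  gcongr
  refine le_trans ?_ (le_iSup _ i)
  gcongr

end SupGradient

/-! ### Elimination of the exponent `q` -/

section MixedNorm

variable {X : Type u} [MeasurableSpace X] {μ : Measure X} {p : X → ℝ} {q : X → ℝ≥0∞}

theorem IsExponent.exists_inv_le (hq : IsExponent μ q) :
    ∃ q₀ : ℝ, 0 < q₀ ∧ ∀ᵐ x ∂μ, ((q x)⁻¹).toReal ≤ 1 / q₀ := by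
  -- The truncation at 1 keeps the bound real when `essInf q μ = ∞`.
  have h1 : min (essInf q μ) 1 ≠ ∞ := ne_top_of_le_ne_top ENNReal.one_ne_top (min_le_right _ _)
  have h0 : 0 < min (essInf q μ) 1 := lt_min hq.essInf_pos one_pos
  refine ⟨(min (essInf q μ) 1).toReal, ENNReal.toReal_pos h0.ne' h1, ?_⟩
  filter_upwards [ae_essInf_le (f := q) (μ := μ)] with x hx
  rw [one_div, ← ENNReal.toReal_inv]
  apply ENNReal.toReal_mono (ENNReal.inv_ne_top.2 h0.ne')
  exact ENNReal.inv_le_inv.2 ((min_le_left _ _).trans hx)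

theorem modular_mono {f g : X → ℝ≥0∞} (hp : ∀ x, 0 < p x) (h : ∀ᵐ x ∂μ, f x ≤ g x) :
    modular μ p f ≤ modular μ p g := by
  apply lintegral_mono_ae
  filter_upwards [h] with x hx
  exact ENNReal.rpow_le_rpow hx (hp x).le

theorem div_ofReal_div_ofReal (a : ℝ≥0∞) {s : ℝ} (hs : 0 < s) (t : ℝ) :
    a / ENNReal.ofReal s / ENNReal.ofReal t = a / ENNReal.ofReal (s * t) := by
  rw [ENNReal.ofReal_mul hs.le, div_eq_mul_inv, div_eq_mul_inv, div_eq_mul_inv,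
    ENNReal.mul_inv (Or.inl (by simpa using hs)) (Or.inl ENNReal.ofReal_ne_top), mul_assoc]

/-- For some `l' < l` each infimum in the mixed modular of `g / l'` is at most 1, hence below `η =
(l / l') ^ q₀ > 1`. An admissible `t < η` satisfies `t ^ (1 / q x) ≤ l / l'` almost everywhere. The
resulting bound has no constant, hence no dependence on `q`. -/
theorem modular_div_le_one_of_mixedNorm_lt (hp : ∀ x, 0 < p x) (hq : IsExponent μ q)
    {g : ℤ → X → ℝ≥0∞} {l : ℝ} (h : mixedNorm μ p q g < ENNReal.ofReal l) (k : ℤ) :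
    modular μ p (fun x => g k x / ENNReal.ofReal l) ≤ 1 := by
  obtain ⟨q₀, hq₀, hqx⟩ := hq.exists_inv_le
  simp only [mixedNorm, iInf_lt_iff] at h
  obtain ⟨l', hl', hmod, hll⟩ := h
  have hll' : l' < l := (ENNReal.ofReal_lt_ofReal_iff_of_nonneg hl'.le).1 hll
  have hquot : 1 < l / l' := (one_lt_div hl').2 hll'
  set η : ℝ := (l / l') ^ q₀ with hη
  have hη1 : 1 < η := Real.one_lt_rpow hquot hq₀
  have hk := ((ENNReal.le_tsum k).trans hmod).trans_lt
    (show (1 : ℝ≥0∞) < ENNReal.ofReal η by rwa [ENNReal.one_lt_ofReal])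
  simp only [iInf_lt_iff] at hk
  obtain ⟨t, ht, hmt, htη⟩ := hk
  have htη' : t < η := (ENNReal.ofReal_lt_ofReal_iff_of_nonneg ht.le).1 htη
  refine (modular_mono hp ?_).trans hmt
  filter_upwards [hqx] with x hx
  rw [div_ofReal_div_ofReal _ hl']
  apply ENNReal.div_le_div_left
  apply ENNReal.ofReal_le_ofReal
  have h1 : t ^ ((q x)⁻¹).toReal ≤ η ^ (1 / q₀) := by
    calc t ^ ((q x)⁻¹).toReal ≤ η ^ ((q x)⁻¹).toReal := by gcongr
      _ ≤ η ^ (1 / q₀) := Real.rpow_le_rpow_of_exponent_le hη1.le hx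
  have h2 : η ^ (1 / q₀) = l / l' := by
    rw [hη, ← Real.rpow_mul (by positivity), mul_one_div_cancel hq₀.ne', Real.rpow_one]
  calc l' * t ^ ((q x)⁻¹).toReal ≤ l' * (l / l') := by rw [← h2]; gcongr
    _ = l := by field_simp

/-- Dividing further by `N ^ (1 / q₀)`, with `N ≥ 1`, divides the mixed modular by at least `N`. The
value obtained depends on `q`, but only finiteness is used. -/
theorem MemMixed.mixedNorm_lt_top (hp : ∀ x, 0 < p x) (hq : IsExponent μ q)
    {g : ℤ → X → ℝ≥0∞} (hg : MemMixed μ p q g) : mixedNorm μ p q g < ∞ := by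
  obtain ⟨q₀, hq₀, hqx⟩ := hq.exists_inv_le
  obtain ⟨l, hl, hV⟩ := hg.2
  set N : ℝ := max 1 (mixedModular μ p q (fun k x => g k x / ENNReal.ofReal l)).toReal with hN
  have hN1 : 1 ≤ N := le_max_left _ _
  have hN0 : 0 < N := by linarith
  have hVN : mixedModular μ p q (fun k x => g k x / ENNReal.ofReal l) ≤ ENNReal.ofReal N := by
    rw [← ENNReal.ofReal_toReal hV.ne]
    exact ENNReal.ofReal_le_ofReal (le_max_right _ _)
  have hl'0 : 0 < l * N ^ (1 / q₀) := by positivity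
  refine lt_of_le_of_lt (b := ENNReal.ofReal (l * N ^ (1 / q₀))) ?_ ENNReal.ofReal_lt_top
  refine iInf_le_of_le _ (iInf_le_of_le hl'0 (iInf_le_of_le ?_ le_rfl))
  have key : mixedModular μ p q (fun k x => g k x / ENNReal.ofReal (l * N ^ (1 / q₀))) *
      ENNReal.ofReal N ≤ 1 * ENNReal.ofReal N := by
    rw [one_mul]
    refine le_trans ?_ hVN
    unfold mixedModular
    rw [← ENNReal.tsum_mul_right]
    refine ENNReal.tsum_le_tsum fun k => ?_
    refine le_iInf fun t => le_iInf fun ht => le_iInf fun hmt => ?_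
    have e : ENNReal.ofReal t = ENNReal.ofReal (t / N) * ENNReal.ofReal N := by
      rw [← ENNReal.ofReal_mul (by positivity), div_mul_cancel₀ _ hN0.ne']
    rw [e]
    gcongr
    refine iInf_le_of_le (t / N) (iInf_le_of_le (by positivity) (iInf_le_of_le ?_ le_rfl))
    refine (modular_mono hp ?_).trans hmt
    filter_upwards [hqx] with x hx
    rw [div_ofReal_div_ofReal _ hl, div_ofReal_div_ofReal _ hl'0]
    apply ENNReal.div_le_div_left
    apply ENNReal.ofReal_le_ofReal
    rw [Real.div_rpow ht.le hN0.le, mul_assoc]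
    have h1 : N ^ ((q x)⁻¹).toReal ≤ N ^ (1 / q₀) :=
      Real.rpow_le_rpow_of_exponent_le hN1 hx
    have h2 : 0 < N ^ ((q x)⁻¹).toReal := by positivity
    gcongr
    rw [mul_div_assoc', le_div_iff₀ h2, mul_comm]
    gcongr
  rwa [ENNReal.mul_le_mul_iff_left (by simpa using hN0) ENNReal.ofReal_ne_top] at key

theorem iSup_rpow_le_tsum {ι : Type*} (f : ι → ℝ≥0∞) {r : ℝ} (hr : 0 < r) :
    (⨆ i, f i) ^ r ≤ ∑' i, f i ^ r := by
  rw [← ENNReal.le_rpow_inv_iff hr]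
  refine iSup_le fun i => ?_
  rw [ENNReal.le_rpow_inv_iff hr]
  exact ENNReal.le_tsum (f := fun i => f i ^ r) i

variable {a A κ : ℝ}

theorem measurable_supGradient {m : ℕ} {g : ℤ → X → ℝ≥0∞} (hg : ∀ k, Measurable (g k)) :
    Measurable (supGradient A κ m g) :=
  Measurable.iSup fun _ => (hg _).const_mul _

/-- The power `p x` of a supremum is at most the sum of the powers, and the weights raised to `p x ≥
a` still decay geometrically. No triangle inequality enters, so `p < 1` is allowed. -/
theorem modular_supGradient_le (ha : 0 < a) (hA : 0 ≤ A) (hκ : 0 < κ)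
    (hpm : Measurable p) (hp : ∀ x, p x ∈ Icc a A) {m : ℕ} {g : ℤ → X → ℝ≥0∞}
    (hg : ∀ k, Measurable (g k)) {l : ℝ}
    (h : ∀ k, modular μ p (fun x => g k x / ENNReal.ofReal l) ≤ 1) :
    modular μ p (fun x => supGradient A κ m g x / ENNReal.ofReal l) ≤
      ENNReal.ofReal ((((2 : ℝ) ^ m) ^ A) ^ A * (1 - ((1 / 2 : ℝ) ^ κ) ^ a)⁻¹) := by
  set B : ℝ := ((2 : ℝ) ^ m) ^ A with hB
  have hB1 : 1 ≤ B := Real.one_le_rpow (one_le_pow₀ (by norm_num)) hA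
  set θ : ℝ := (1 / 2 : ℝ) ^ κ with hθ
  have hθ0 : 0 < θ := by positivity
  have hθ1 : θ < 1 := Real.rpow_lt_one (by norm_num) (by norm_num) hκ
  have hθa0 : 0 < θ ^ a := by positivity
  have hθa1 : θ ^ a < 1 := Real.rpow_lt_one hθ0.le hθ1 ha
  have hpt : ∀ x, (supGradient A κ m g x / ENNReal.ofReal l) ^ p x ≤
      ∑' i : ℕ, ENNReal.ofReal (B ^ A * (θ ^ a) ^ i) * (g (i - m) x / ENNReal.ofReal l) ^ p x := by
    intro x
    have hpx : 0 < p x := ha.trans_le (hp x).1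
    rw [supGradient, ENNReal.iSup_div]
    refine (iSup_rpow_le_tsum _ hpx).trans (ENNReal.tsum_le_tsum fun i => ?_)
    rw [mul_div_assoc, ENNReal.mul_rpow_of_nonneg _ _ hpx.le,
      ENNReal.ofReal_rpow_of_nonneg (by positivity) hpx.le]
    gcongr
    rw [Real.mul_rpow (by positivity) (by positivity)]
    gcongr ?_ * ?_
    · exact Real.rpow_le_rpow_of_exponent_le hB1 (hp x).2
    · calc (θ ^ i) ^ p x ≤ (θ ^ i) ^ a :=
            Real.rpow_le_rpow_of_exponent_ge (by positivity) (pow_le_one₀ hθ0.le hθ1.le) (hp x).1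
        _ = (θ ^ a) ^ i := by
            rw [← Real.rpow_natCast, ← Real.rpow_natCast, ← Real.rpow_mul hθ0.le,
              ← Real.rpow_mul hθ0.le, mul_comm]
  calc modular μ p (fun x => supGradient A κ m g x / ENNReal.ofReal l)
      ≤ ∫⁻ x, ∑' i : ℕ, ENNReal.ofReal (B ^ A * (θ ^ a) ^ i) *
          (g (i - m) x / ENNReal.ofReal l) ^ p x ∂μ := lintegral_mono hpt
    _ = ∑' i : ℕ, ∫⁻ x, ENNReal.ofReal (B ^ A * (θ ^ a) ^ i) *
          (g (i - m) x / ENNReal.ofReal l) ^ p x ∂μ :=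
        lintegral_tsum fun i => ((((hg _).div_const _).pow hpm).const_mul _).aemeasurable
    _ ≤ ∑' i : ℕ, ENNReal.ofReal (B ^ A * (θ ^ a) ^ i) := by
        refine ENNReal.tsum_le_tsum fun i => ?_
        rw [lintegral_const_mul _ (((hg _).div_const _).pow hpm)]
        exact mul_le_of_le_one_right' (h _)
    _ = ENNReal.ofReal (B ^ A * (1 - θ ^ a)⁻¹) := by
        rw [← ENNReal.ofReal_tsum_of_nonneg (fun i => by positivity)
          ((summable_geometric_of_lt_one hθa0.le hθa1).mul_left _), tsum_mul_left,
          tsum_geometric_of_lt_one hθa0.le hθa1]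

end MixedNorm

/-! ### From vector gradients to normalized scalar gradients -/

section Reduction

variable {X : Type u} [MetricSpace X] [MeasurableSpace X] {μ : Measure X}

/-- The exceptional set is open and null, hence empty. This turns the essential bounds on the
continuous exponents into bounds at every point. -/
theorem forall_le_of_ae_le [μ.IsOpenPosMeasure] {f g : X → ℝ} (hf : Continuous f)
    (hg : Continuous g) (h : ∀ᵐ x ∂μ, f x ≤ g x) (x : X) : f x ≤ g x := by
  have ho : IsOpen {x | g x < f x} := isOpen_lt hg hf
  have h0 : μ {x | g x < f x} = 0 := by
    rw [← nonpos_iff_eq_zero, ← ae_iff.1 h]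
    exact measure_mono fun y hy => not_le.2 hy
  by_contra hc
  have : x ∈ {x | g x < f x} := not_le.1 hc
  rw [(ho.measure_eq_zero_iff μ).1 h0] at this
  exact this

theorem IsLogExponent.continuous {a A L : ℝ} {f : X → ℝ} (hf : IsLogExponent μ a A L f) :
    Continuous f := by
  have h1 := hf.logHolder.logComparable.continuous
  have h2 : Continuous fun x => 1 / (1 / f x) :=
    continuous_const.div h1 fun x => (one_div_pos.2 (hf.pos x)).ne'
  simpa using h2

theorem IsLogExponent.mem_Icc [μ.IsOpenPosMeasure] {a A L : ℝ} {f : X → ℝ}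
    (hf : IsLogExponent μ a A L f) (x : X) : f x ∈ Icc a (max A 1) :=
  ⟨forall_le_of_ae_le continuous_const hf.continuous hf.ess_lower x,
    (forall_le_of_ae_le hf.continuous continuous_const hf.ess_upper x).trans (le_max_left _ _)⟩

theorem IsLogExponent.logComparable [μ.IsOpenPosMeasure] {a A L : ℝ} {f : X → ℝ}
    (hf : IsLogExponent μ a A L f) :
    LogComparable (max A 1 * max A 1 * max L 0) f :=
  hf.logHolder.logComparable.of_one_div hf.pos fun x => (hf.mem_Icc x).2

/-- A common log-Hölder constant for `p`, `Q`, `s`, `ε` and `ε - Q / p`. -/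
noncomputable def logConst (a A L : ℝ) : ℝ :=
  max A 1 * max A 1 * max L 0 +
    (max A 1 * max L 0 + 1 / a * (max A 1 * max A 1 * max L 0))

theorem IsLogExponent.logComparable_logConst [μ.IsOpenPosMeasure] {a A L : ℝ} (ha : 0 < a)
    {f : X → ℝ} (hf : IsLogExponent μ a A L f) : LogComparable (logConst a A L) f :=
  hf.logComparable.mono (by
    unfold logConst
    have : 0 ≤ max A 1 * max L 0 + 1 / a * (max A 1 * max A 1 * max L 0) := by positivity
    linarith)

variable [BorelSpace X] {b δ D a A L κ : ℝ} {Q p s ε : X → ℝ}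

theorem Setting.isOpenPosMeasure (hs : Setting μ b δ D a A L κ Q p s ε) :
    μ.IsOpenPosMeasure := by
  refine ⟨fun U hU ⟨x, hx⟩ => ?_⟩
  obtain ⟨r, hr, hball⟩ := Metric.isOpen_iff.1 hU x hx
  exact ((hs.ball_pos x r hr).trans_le (measure_mono hball)).ne'

theorem Setting.measure_univ_lt_top (hs : Setting μ b δ D a A L κ Q p s ε) : μ univ < ∞ := by
  rcases isEmpty_or_nonempty X with hX | ⟨⟨x⟩⟩
  · simp [univ_eq_empty_iff.2 hX]
  · obtain ⟨r, hr, h⟩ := hs.bounded.subset_ball_lt 0 x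
    exact (measure_mono h).trans_lt (hs.ball_lt_top x r hr)

theorem Setting.dist_le (hs : Setting μ b δ D a A L κ Q p s ε) (x y : X) : dist x y ≤ D :=
  hs.diam_eq ▸ Metric.dist_le_diam_of_mem hs.bounded (mem_univ x) (mem_univ y)

theorem Setting.logComparable_sub_div (hs : Setting μ b δ D a A L κ Q p s ε) (ha : 0 < a) :
    LogComparable (logConst a A L) (fun x => ε x - Q x / p x) := by
  have := hs.isOpenPosMeasure
  have h1 := hs.exponent_Q.logComparable.mul hs.exponent_p.logHolder.logComparable
    (A := max A 1) (B := 1 / a) (fun x => by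
      rw [abs_of_pos (hs.exponent_Q.pos x)]; exact (hs.exponent_Q.mem_Icc x).2)
    (fun x => by
      rw [abs_of_pos (one_div_pos.2 (hs.exponent_p.pos x))]
      exact one_div_le_one_div_of_le ha (hs.exponent_p.mem_Icc x).1)
  have h2 := hs.exponent_ε.logComparable.add h1.neg
  have e : (fun x => ε x - Q x / p x) = fun x => ε x + -(Q x * (1 / p x)) := by
    funext x; ring
  rw [e]
  exact h2

/-- Passage from a vector gradient in a mixed space to a normalized scalar gradient. -/
theorem exists_hajlaszPair (b δ D a A L κ : ℝ) (ha : 0 < a) (hκ : 0 < κ) :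
    ∃ K : ℝ, 0 < K ∧ ∀ {X : Type u} [MetricSpace X] [MeasurableSpace X] [BorelSpace X]
      {μ : Measure X} {Q p s ε : X → ℝ} {q : X → ℝ≥0∞},
      Setting μ b δ D a A L κ Q p s ε → IsExponent μ q →
      ∀ {u : X → EReal} {g : ℤ → X → ℝ≥0∞}, MeasFiniteAE μ u →
      IsVectorGradient μ s u g → MemMixed μ p q g →
      ∃ (h : X → ℝ) (S : Set X), Measurable h ∧ (∀ x ∈ S, u x = ((u x).toReal : EReal)) ∧
        ∀ l : ℝ, mixedNorm μ p q g < ENNReal.ofReal l →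
        HajlaszPair μ b (min δ 1) D a (max A 1) (logConst a A L) K Q p ε S
          (fun x => (u x).toReal / l) (fun x => h x / l) := by
  obtain ⟨m, hm⟩ := pow_unbounded_of_one_lt D (by norm_num : (1 : ℝ) < 2)
  set A' : ℝ := max A 1 with hA'
  have hA1 : 1 ≤ A' := le_max_right _ _
  have hθ1 : ((1 / 2 : ℝ) ^ κ) ^ a < 1 := Real.rpow_lt_one (by positivity)
    (Real.rpow_lt_one (by norm_num) (by norm_num) hκ) ha
  refine ⟨(((2 : ℝ) ^ m) ^ A') ^ A' * (1 - ((1 / 2 : ℝ) ^ κ) ^ a)⁻¹, ?_, ?_⟩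
  · have : 0 < 1 - ((1 / 2 : ℝ) ^ κ) ^ a := by linarith
    positivity
  intro X _ _ _ μ Q p s ε q hs hq u g hu hgrad hmem
  have := hs.isOpenPosMeasure
  have hgap : ∀ x, κ ≤ s x - ε x := forall_le_of_ae_le continuous_const
    (hs.exponent_s.continuous.sub hs.exponent_ε.continuous) hs.gap
  obtain ⟨hgm, N, hN, hNle⟩ := hgrad
  set h : X → ℝ≥0∞ := supGradient A' κ m g with hh
  have hhm : Measurable h := measurable_supGradient hgm
  have hmod : ∀ l : ℝ, mixedNorm μ p q g < ENNReal.ofReal l → _ := fun l hl =>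
    modular_supGradient_le (μ := μ) ha (by linarith) hκ hs.exponent_p.measurable
      (fun x => hs.exponent_p.mem_Icc x) (m := m) hgm
      (modular_div_le_one_of_mixedNorm_lt hs.exponent_p.pos hq hl)
  have hfin := hmem.mixedNorm_lt_top hs.exponent_p.pos hq
  have hae : ∀ᵐ x ∂μ, h x < ∞ := by
    obtain ⟨l, hl0, hl⟩ : ∃ l : ℝ, 0 < l ∧ mixedNorm μ p q g < ENNReal.ofReal l := by
      refine ⟨(mixedNorm μ p q g).toReal + 1, by positivity, ?_⟩
      exact (ENNReal.lt_ofReal_iff_toReal_lt hfin.ne).2 (by linarith)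
    have h1 := ae_lt_top ((hhm.div_const (ENNReal.ofReal l)).pow hs.exponent_p.measurable)
      ((hmod l hl).trans_lt ENNReal.ofReal_lt_top).ne
    filter_upwards [h1] with x hx
    by_contra hc
    rw [not_lt, top_le_iff] at hc
    simp only [hc, ENNReal.top_div_of_ne_top ENNReal.ofReal_ne_top,
      ENNReal.top_rpow_of_pos (hs.exponent_p.pos x), lt_self_iff_false] at hx
  -- `h` and `S` are fixed before `l`, so that `l` can later tend to the norm, even when the norm is
  -- 0.
  refine ⟨fun x => (h x).toReal, {x | x ∉ N ∧ (u x ≠ ⊤ ∧ u x ≠ ⊥) ∧ h x < ∞},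
    hhm.ennreal_toReal, fun x hx => (EReal.coe_toReal hx.2.1.1 hx.2.1.2).symm, fun l hl => ?_⟩
  have hl0 : 0 < l := by
    rw [← ENNReal.ofReal_pos]; exact bot_le.trans_lt hl
  refine ⟨hs.dist_le, fun x r => measurableSet_ball, fun x r hr hrR =>
    hs.lower_regular x r hr (hrR.trans (min_le_left _ _)), hs.exponent_Q.mem_Icc,
    hs.exponent_p.mem_Icc, hs.exponent_ε.mem_Icc, hs.exponent_Q.logComparable_logConst ha,
    hs.exponent_p.logComparable_logConst ha,
    hs.exponent_ε.logComparable_logConst ha, ?_, fun x => by positivity, ?_, ?_⟩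
  · have hNae : ∀ᵐ x ∂μ, x ∉ N := measure_eq_zero_iff_ae_notMem.1 hN
    have : ∀ᵐ x ∂μ, x ∈ {x | x ∉ N ∧ (u x ≠ ⊤ ∧ u x ≠ ⊥) ∧ h x < ∞} := by
      filter_upwards [hNae, hu.2, hae] with x h1 h2 h3 using ⟨h1, h2, h3⟩
    exact this
  · rintro x ⟨hxN, hxu, hxh⟩ y ⟨hyN, hyu, hyh⟩
    rcases eq_or_ne x y with rfl | hxy
    · rw [sub_self, abs_zero]; positivity
    have hd : 0 < dist x y := dist_pos.2 hxy
    have hdm : dist x y < 2 ^ m := (hs.dist_le x y).trans_lt hm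
    -- The dyadic band `2 ^ n ≤ d < 2 ^ (n + 1)` belongs to the index `k = -n - 1 = i - m`; `d < 2 ^
    -- m` forces `n < m`, hence `i ≥ 0`.
    obtain ⟨n, hn1, hn2⟩ := exists_mem_Ico_zpow hd (by norm_num : (1 : ℝ) < 2)
    have hnm : n < m := by
      have : (2 : ℝ) ^ n < 2 ^ (m : ℤ) := hn1.trans_lt (by exact_mod_cast hdm)
      exact (zpow_lt_zpow_iff_right₀ (by norm_num)).1 this
    obtain ⟨i, hi⟩ : ∃ i : ℕ, (i : ℤ) = m - n - 1 := ⟨(m - n - 1 : ℤ).toNat, by omega⟩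
    have hk : (i - m : ℤ) = -n - 1 := by omega
    have key := hNle (i - m) x y hxN hyN (by
        rwa [hk, show (-(-n - 1) - 1 : ℤ) = n by omega])
      (by rwa [hk, show (-(-n - 1) : ℤ) = n + 1 by omega])
    have hdi : dist x y < 2 ^ m * (1 / 2) ^ i := by
      refine hn2.trans_le (le_of_eq ?_)
      rw [one_div, inv_pow, ← zpow_natCast, ← zpow_natCast, ← zpow_neg,
        ← zpow_add₀ (by norm_num)]
      congr 1; omega
    have bx := ofReal_rpow_mul_le_supGradient hκ hd hdi (hs.exponent_ε.pos x).le
      (hs.exponent_s.mem_Icc x).2 (hgap x) g x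
    have bz := ofReal_rpow_mul_le_supGradient hκ hd hdi (hs.exponent_ε.pos y).le
      (hs.exponent_s.mem_Icc y).2 (hgap y) g y
    have h2 := key.trans (add_le_add bx bz)
    rw [← EReal.coe_toReal hxu.1 hxu.2, ← EReal.coe_toReal hyu.1 hyu.2, ← EReal.coe_sub,
      EReal.abs_def, ← hh, ← ENNReal.ofReal_toReal hxh.ne, ← ENNReal.ofReal_toReal hyh.ne,
      ← ENNReal.ofReal_mul (by positivity), ← ENNReal.ofReal_mul (by positivity),
      ← ENNReal.ofReal_add (by positivity) (by positivity),
      ENNReal.ofReal_le_ofReal_iff (by positivity)] at h2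
    rw [← sub_div, abs_div, abs_of_pos hl0, mul_div_assoc', mul_div_assoc', ← add_div]
    gcongr
  · refine le_trans (lintegral_mono fun x => ?_) (hmod l hl)
    rw [← ENNReal.ofReal_rpow_of_nonneg (by positivity) (hs.exponent_p.pos x).le,
      ENNReal.ofReal_div_of_pos hl0]
    exact ENNReal.rpow_le_rpow (ENNReal.div_le_div_right ENNReal.ofReal_toReal_le _)
      (hs.exponent_p.pos x).le

end Reduction

/-! ### Passage to the limit in `l`, Luxemburg norms, mean values -/

section Auxiliary

theorem le_mul_of_forall_lt_le_mul {F N G : ℝ} (h : ∀ l, N < l → F ≤ l * G) : F ≤ N * G :=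
  ge_of_tendsto (f := fun l : ℝ => l * G) (x := nhdsWithin N (Ioi N))
    (((continuous_id.mul continuous_const).tendsto N).mono_left nhdsWithin_le_nhds)
    (eventually_mem_nhdsWithin.mono fun l hl => h l hl)

/-- Estimates are available only for `l` strictly above the norm; letting `l` decrease to it also
covers norm 0. -/
theorem le_ofReal_mul_of_forall_lt {F N : ℝ≥0∞} {C : ℝ} (hC : 0 < C)
    (h : ∀ l : ℝ, N < ENNReal.ofReal l → F ≤ ENNReal.ofReal (l * C)) :
    F ≤ ENNReal.ofReal C * N := by
  rcases eq_or_ne N ∞ with rfl | hN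
  · rw [ENNReal.mul_top (by simpa using hC)]; exact le_top
  have hF : F ≠ ∞ := by
    refine ne_top_of_le_ne_top ENNReal.ofReal_ne_top (h (N.toReal + 1) ?_)
    exact (ENNReal.lt_ofReal_iff_toReal_lt hN).2 (by linarith)
  have h1 : F.toReal ≤ N.toReal * C := by
    refine le_mul_of_forall_lt_le_mul fun l hl => ?_
    have hl0 : 0 ≤ l := ENNReal.toReal_nonneg.trans hl.le
    exact ENNReal.toReal_le_of_le_ofReal (by positivity)
      (h l ((ENNReal.lt_ofReal_iff_toReal_lt hN).2 hl))
  rw [← ENNReal.ofReal_toReal hF, ← ENNReal.ofReal_toReal hN, ← ENNReal.ofReal_mul hC.le,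
    mul_comm]
  exact ENNReal.ofReal_le_ofReal h1

variable {X : Type u} [MeasurableSpace X] {μ : Measure X} {p : X → ℝ}

theorem luxNorm_le {f : X → ℝ≥0∞} {c : ℝ} (hc : 0 < c)
    (h : modular μ p (fun x => f x / ENNReal.ofReal c) ≤ 1) :
    luxNorm μ p f ≤ ENNReal.ofReal c :=
  iInf_le_of_le c (iInf_le_of_le hc (iInf_le_of_le h le_rfl))

theorem modular_div_le_one_of_luxNorm_lt (hp : ∀ x, 0 < p x) {f : X → ℝ≥0∞} {l : ℝ}
    (h : luxNorm μ p f < ENNReal.ofReal l) :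
    modular μ p (fun x => f x / ENNReal.ofReal l) ≤ 1 := by
  simp only [luxNorm, iInf_lt_iff] at h
  obtain ⟨l', -, hm, hll⟩ := h
  exact (modular_mono hp (ae_of_all _ fun x => ENNReal.div_le_div_left hll.le _)).trans hm

/-- Used to replace the reference value `c`, taken at a good point, by the mean of `u`. -/
theorem integrable_and_abs_mean_sub_le [IsFiniteMeasure μ] (hμ : μ ≠ 0) {u : X → EReal}
    (hu : Measurable u) {c B : ℝ} (hB : 0 ≤ B) {G : X → ℝ}
    (hG : ∀ᵐ x ∂μ, |(u x).toReal - c| ≤ G x)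
    (hint : ∫⁻ x, ENNReal.ofReal (G x) ∂μ ≤ ENNReal.ofReal B * μ univ) :
    Integrable (fun x => (u x).toReal) μ ∧ |mean μ u - c| ≤ B := by
  have hm : Measurable fun x => (u x).toReal - c := hu.ereal_toReal.sub_const c
  have hle : ∫⁻ x, ‖(u x).toReal - c‖ₑ ∂μ ≤ ENNReal.ofReal B * μ univ := by
    refine (lintegral_mono_ae ?_).trans hint
    filter_upwards [hG] with x hx
    rw [Real.enorm_eq_ofReal_abs]
    exact ENNReal.ofReal_le_ofReal hx
  have hfin : ENNReal.ofReal B * μ univ < ∞ :=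
    ENNReal.mul_lt_top ENNReal.ofReal_lt_top (measure_lt_top _ _)
  have hi : Integrable (fun x => (u x).toReal - c) μ :=
    ⟨hm.aestronglyMeasurable, hle.trans_lt hfin⟩
  have hui : Integrable (fun x => (u x).toReal) μ :=
    (hi.add (integrable_const c)).congr (ae_of_all _ fun x => sub_add_cancel _ _)
  refine ⟨hui, ?_⟩
  have hpos : 0 < μ.real univ :=
    ENNReal.toReal_pos (Measure.measure_univ_ne_zero.2 hμ) (measure_ne_top _ _)
  have h1 : |∫ x, ((u x).toReal - c) ∂μ| ≤ B * μ.real univ := by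
    have h2 := (enorm_integral_le_lintegral_enorm (fun x => (u x).toReal - c)).trans hle
    rw [Real.enorm_eq_ofReal_abs] at h2
    have h3 := (ENNReal.ofReal_le_iff_le_toReal hfin.ne).1 h2
    rwa [ENNReal.toReal_mul, ENNReal.toReal_ofReal hB] at h3
  rw [integral_sub hui (integrable_const c), integral_const, smul_eq_mul] at h1
  have e : mean μ u - c = (∫ x, (u x).toReal ∂μ - μ.real univ * c) / μ.real univ := by
    rw [mean, average_eq, smul_eq_mul]
    field_simp
  rw [e, abs_div, abs_of_pos hpos, div_le_iff₀ hpos]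
  exact h1

end Auxiliary

/-! ### Integrating the pointwise bounds -/

section PairIntegrals

variable {X : Type u} [MetricSpace X] [MeasurableSpace X] {μ : Measure X}
  {b R D a A M K κ : ℝ} {Q p ε : X → ℝ} {S : Set X} {v H : X → ℝ}

theorem max_one_rpow_le {t r : ℝ} (ht : 0 ≤ t) : (max 1 t) ^ r ≤ 1 + t ^ r := by
  have h0 : 0 ≤ t ^ r := by positivity
  rcases le_total 1 t with h | h
  · rw [max_eq_right h]; linarith
  · rw [max_eq_left h, Real.one_rpow]; linarith

theorem HajlaszPair.ae_mem (h : HajlaszPair μ b R D a A M K Q p ε S v H) : ∀ᵐ x ∂μ, x ∈ S :=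
  h.null

theorem HajlaszPair.lintegral_le (h : HajlaszPair μ b R D a A M K Q p ε S v H) :
    ∫⁻ x, ENNReal.ofReal ((max 1 (H x)) ^ p x) ∂μ ≤ μ univ + ENNReal.ofReal K := by
  calc ∫⁻ x, ENNReal.ofReal ((max 1 (H x)) ^ p x) ∂μ
      ≤ ∫⁻ x, (1 + ENNReal.ofReal (H x ^ p x)) ∂μ := by
        refine lintegral_mono fun x => ?_
        rw [← ENNReal.ofReal_one, ← ENNReal.ofReal_add zero_le_one
          (Real.rpow_nonneg (h.nonneg x) _)]
        exact ENNReal.ofReal_le_ofReal (max_one_rpow_le (h.nonneg x))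
    _ = μ univ + ∫⁻ x, ENNReal.ofReal (H x ^ p x) ∂μ := by
        rw [lintegral_add_left measurable_const, lintegral_one]
    _ ≤ _ := by gcongr; exact h.modular_le

/-- One ball of radius `R` already gives `μ univ ≥ b * R ^ A`, so `K` is absorbed into a multiple of
`μ univ`. This keeps the critical constants independent of the total mass. -/
theorem HajlaszPair.lintegral_le_mul_measure_univ
    (h : HajlaszPair μ b R D a A M K Q p ε S v H) (hb : 0 < b) (hR : 0 < R) (hR1 : R ≤ 1)
    (hK : 0 ≤ K) (x₀ : X) :
    ∫⁻ x, ENNReal.ofReal ((max 1 (H x)) ^ p x) ∂μ ≤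
      ENNReal.ofReal (1 + K / (b * R ^ A)) * μ univ := by
  have hm : ENNReal.ofReal (b * R ^ A) ≤ μ univ := by
    refine le_trans (ENNReal.ofReal_le_ofReal ?_)
      ((h.lower_regular x₀ R hR le_rfl).trans (measure_mono (subset_univ _)))
    exact mul_le_mul_of_nonneg_left
      (Real.rpow_le_rpow_of_exponent_ge hR hR1 (h.Q_mem x₀).2) hb.le
  have hpos : 0 < b * R ^ A := by positivity
  refine h.lintegral_le.trans ?_
  rw [ENNReal.ofReal_add zero_le_one (by positivity), ENNReal.ofReal_one, add_mul, one_mul]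
  gcongr
  calc ENNReal.ofReal K = ENNReal.ofReal (K / (b * R ^ A)) * ENNReal.ofReal (b * R ^ A) := by
        rw [← ENNReal.ofReal_mul (by positivity), div_mul_cancel₀ _ hpos.ne']
    _ ≤ _ := by gcongr

/-- The Sobolev exponent `γ` satisfies `(1 - ε p / Q) γ = p`, so the bound on `f` becomes `(max 1 H)
^ p`, with integral at most `m + K`. As `γ ≥ p ≥ a`, the divisor `(m + K + 1) ^ (1 / a)` contributes
at most `1 / (m + K + 1)`. -/
theorem HajlaszPair.modular_sobolev_le_one (h : HajlaszPair μ b R D a A M K Q p ε S v H)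
    (ha : 0 < a) (hK : 0 ≤ K) (hgap : ∀ x, 0 < Q x - ε x * p x) {m : ℝ≥0} (hm : μ univ = m)
    {C : ℝ} (hC : 0 < C) {f : X → ℝ≥0∞}
    (hf : ∀ x ∈ S, f x ≤ ENNReal.ofReal (C * (max 1 (H x)) ^ (1 - ε x * p x / Q x))) :
    modular μ (fun x => Q x * p x / (Q x - ε x * p x))
      (fun x => f x / ENNReal.ofReal (C * (m + K + 1) ^ (1 / a))) ≤ 1 := by
  set N : ℝ := m + K + 1 with hN
  have hN1 : 1 ≤ N := by
    have : (0 : ℝ) ≤ m := m.2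
    linarith
  have hN0 : 0 < N := by linarith
  have key : ∀ x ∈ S, (f x / ENNReal.ofReal (C * N ^ (1 / a))) ^
      (Q x * p x / (Q x - ε x * p x)) ≤
      ENNReal.ofReal N⁻¹ * ENNReal.ofReal ((max 1 (H x)) ^ p x) := by
    intro x hx
    have hp : 0 < p x := ha.trans_le (h.p_mem x).1
    have hQ : 0 < Q x := ha.trans_le (h.Q_mem x).1
    have hε : 0 < ε x := ha.trans_le (h.ε_mem x).1
    have hg := hgap x
    have ht1 : 1 ≤ max 1 (H x) := le_max_left _ _
    have ht0 : 0 < max 1 (H x) := by linarith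
    set t := max 1 (H x)
    set γ : ℝ := Q x * p x / (Q x - ε x * p x) with hγ
    have hγ0 : 0 < γ := by positivity
    have hγa : a ≤ γ := by
      refine (h.p_mem x).1.trans ?_
      rw [hγ, le_div_iff₀ hg]
      nlinarith [mul_pos (mul_pos hε hp) hp]
    have e1 : (t ^ (1 - ε x * p x / Q x)) ^ γ = t ^ p x := by
      rw [← Real.rpow_mul ht0.le, hγ]
      congr 1
      field_simp
    have hpos : 0 < C * N ^ (1 / a) := by positivity
    calc (f x / ENNReal.ofReal (C * N ^ (1 / a))) ^ γ
        ≤ (ENNReal.ofReal (C * t ^ (1 - ε x * p x / Q x)) /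
            ENNReal.ofReal (C * N ^ (1 / a))) ^ γ := by
          gcongr
          exact hf x hx
      _ = ENNReal.ofReal ((t ^ (1 - ε x * p x / Q x) / N ^ (1 / a)) ^ γ) := by
          rw [← ENNReal.ofReal_div_of_pos hpos, mul_div_mul_left _ _ hC.ne',
            ENNReal.ofReal_rpow_of_nonneg (by positivity) hγ0.le]
      _ ≤ ENNReal.ofReal (N⁻¹ * t ^ p x) := by
          apply ENNReal.ofReal_le_ofReal
          rw [Real.div_rpow (by positivity) (by positivity), e1, div_eq_mul_inv, mul_comm]
          gcongr
          rw [← Real.rpow_mul hN0.le]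
          calc N = N ^ (1 : ℝ) := (Real.rpow_one _).symm
            _ ≤ N ^ (1 / a * γ) := by
              apply Real.rpow_le_rpow_of_exponent_le hN1
              rwa [one_div, inv_mul_eq_div, one_le_div ha]
      _ = _ := ENNReal.ofReal_mul (by positivity)
  calc modular μ (fun x => Q x * p x / (Q x - ε x * p x))
        (fun x => f x / ENNReal.ofReal (C * N ^ (1 / a)))
      ≤ ∫⁻ x, ENNReal.ofReal N⁻¹ * ENNReal.ofReal ((max 1 (H x)) ^ p x) ∂μ :=
        lintegral_mono_ae (h.ae_mem.mono key)
    _ = ENNReal.ofReal N⁻¹ * ∫⁻ x, ENNReal.ofReal ((max 1 (H x)) ^ p x) ∂μ :=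
        lintegral_const_mul' _ _ ENNReal.ofReal_ne_top
    _ ≤ ENNReal.ofReal N⁻¹ * (μ univ + ENNReal.ofReal K) := by gcongr; exact h.lintegral_le
    _ = ENNReal.ofReal (N⁻¹ * (m + K)) := by
        rw [hm, ENNReal.ofReal_mul (p := N⁻¹) (by positivity), ENNReal.ofReal_add (NNReal.coe_nonneg m) hK,
          ENNReal.ofReal_coe_nnreal]
    _ ≤ 1 := by
        rw [ENNReal.ofReal_le_one, inv_mul_le_iff₀ hN0]
        linarith

/-- A larger gradient is still a gradient. After this enlargement `|v|` too is bounded at good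
points, so `v` itself can be estimated without subtracting a constant. -/
theorem HajlaszPair.max_abs (h : HajlaszPair μ b R D a A M K Q p ε S v H) (hK : 0 ≤ K)
    (hHm : Measurable H) (hpm : Measurable p)
    (hv : ∫⁻ x, ENNReal.ofReal (|v x| ^ p x) ∂μ ≤ 1) :
    HajlaszPair μ b R D a A M (K + 1) Q p ε S v (fun x => max (H x) |v x|) := by
  refine ⟨h.dist_le, h.measurableSet_ball, h.lower_regular, h.Q_mem, h.p_mem, h.ε_mem, h.Q_log,
    h.p_log, h.ε_log, h.null, fun x => (h.nonneg x).trans (le_max_left _ _), ?_, ?_⟩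
  · intro x hx y hy
    refine (h.le x hx y hy).trans ?_
    gcongr
    · exact le_max_left _ _
    · exact le_max_left _ _
  · calc ∫⁻ x, ENNReal.ofReal (max (H x) |v x| ^ p x) ∂μ
        ≤ ∫⁻ x, (ENNReal.ofReal (H x ^ p x) + ENNReal.ofReal (|v x| ^ p x)) ∂μ := by
          refine lintegral_mono fun x => ?_
          rcases max_cases (H x) |v x| with h1 | h1
          · rw [h1.1]; exact le_self_add
          · rw [h1.1]; exact le_add_self
      _ = ∫⁻ x, ENNReal.ofReal (H x ^ p x) ∂μ + ∫⁻ x, ENNReal.ofReal (|v x| ^ p x) ∂μ :=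
          lintegral_add_left (hHm.pow hpm).ennreal_ofReal _
      _ ≤ ENNReal.ofReal K + 1 := add_le_add h.modular_le hv
      _ = ENNReal.ofReal (K + 1) := by
          rw [ENNReal.ofReal_add hK zero_le_one, ENNReal.ofReal_one]

end PairIntegrals

/-! ### The three embeddings -/

section Main

variable {b δ D a A L κ : ℝ}

theorem abs_toReal_sub_div {u : EReal} (hu : u = (u.toReal : EReal)) (c : ℝ) {l : ℝ}
    (hl : 0 < l) : (u - (c : EReal)).abs / ENNReal.ofReal l =
      ENNReal.ofReal |u.toReal / l - c / l| := by
  nth_rewrite 1 [hu]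
  rw [← EReal.coe_sub, EReal.abs_def, ← ENNReal.ofReal_div_of_pos hl, ← sub_div, abs_div,
    abs_of_pos hl]

theorem pos_of_lt_ofReal {N : ℝ≥0∞} {l : ℝ} (h : N < ENNReal.ofReal l) : 0 < l :=
  ENNReal.ofReal_pos.1 (bot_le.trans_lt h)

/-- The Sobolev–Poincaré inequality in the subcritical case. -/
theorem exists_sobolev_poincare (hb : 0 < b) (hδ : 0 < δ) (ha : 0 < a) (hκ : 0 < κ) (m : ℝ≥0) :
    ∃ C : ℝ, 0 < C ∧
      ∀ (X : Type u) [MetricSpace X] [MeasurableSpace X] [BorelSpace X] (μ : Measure X)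
        (Q p s ε : X → ℝ) (q : X → ℝ≥0∞),
        Setting μ b δ D a A L κ Q p s ε → μ univ = m → IsExponent μ q →
        (∀ᵐ x ∂μ, κ ≤ Q x - ε x * p x) →
        ∀ (u : X → EReal) (g : ℤ → X → ℝ≥0∞), MemHomBesov μ s p q u →
          IsVectorGradient μ s u g → MemMixed μ p q g →
          ⨅ c : ℝ, luxNorm μ (fun x => Q x * p x / (Q x - ε x * p x))
              (fun x => (u x - (c : EReal)).abs)
            ≤ ENNReal.ofReal C * mixedNorm μ p q g := by
  have hR : 0 < min δ 1 := lt_min hδ one_pos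
  have hR1 : min δ 1 ≤ 1 := min_le_right _ _
  have hA : 0 < max A 1 := by positivity
  obtain ⟨K, hK, hpair⟩ := exists_hajlaszPair.{u} b δ D a A L κ ha hκ
  obtain ⟨T, hT, hgood⟩ := exists_good_point.{u} (D := D) (A := max A 1)
    (M := logConst a A L) hb hR1 ha hK
  obtain ⟨C, hC, hest⟩ := exists_abs_sub_le_rpow.{u} (D := D) (M := logConst a A L) hb hR hR1 ha
    hA hK hκ (T := T * (min δ 1) ^ (-(max A 1 / a))) (by positivity)
  have hC0 : 0 < C := by linarith
  refine ⟨C * (m + K + 1) ^ (1 / a), by positivity, ?_⟩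
  intro X _ _ _ μ Q p s ε q hs hm hq hgap u g hu hgrad hmem
  have := hs.isOpenPosMeasure
  have hgap' : ∀ x, κ ≤ Q x - ε x * p x := forall_le_of_ae_le continuous_const
    (hs.exponent_Q.continuous.sub (hs.exponent_ε.continuous.mul hs.exponent_p.continuous)) hgap
  obtain ⟨h, S, -, huS, hl⟩ := hpair hs hq hu.1 hgrad hmem
  refine le_ofReal_mul_of_forall_lt (by positivity) fun l hNl => ?_
  have hl0 : 0 < l := pos_of_lt_ofReal hNl
  have hP := hl l hNl
  -- `c` is the value of `u` at one good point. It may vary with `l`, which is harmless under the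
  -- infimum over `c`.
  obtain ⟨c, hc⟩ : ∃ c : ℝ, ∀ x ∈ S, |(u x).toReal / l - c / l| ≤
      C * (max 1 (h x / l)) ^ (1 - ε x * p x / Q x) := by
    rcases isEmpty_or_nonempty X with hX | ⟨⟨x₀⟩⟩
    · exact ⟨0, fun x => hX.elim x⟩
    obtain ⟨y, hy, -, hHy⟩ := hgood hP x₀ _ hR le_rfl
    refine ⟨(u y).toReal, fun x hx => hest hP hgap' x hx y hy (hHy.trans ?_)⟩
    exact mul_le_mul_of_nonneg_left (hP.rpow_neg_div_le ha hR hR1 x₀) (by linarith)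
  refine iInf_le_of_le c (luxNorm_le (by positivity) ?_)
  have := hP.modular_sobolev_le_one ha hK.le (fun x => hκ.trans_le (hgap' x)) hm hC0
    (f := fun x => (u x - (c : EReal)).abs / ENNReal.ofReal l) (fun x hx => by
      rw [abs_toReal_sub_div (huS x hx) c hl0]
      exact ENNReal.ofReal_le_ofReal (hc x hx))
  simpa only [div_ofReal_div_ofReal _ hl0] using this

/-- The Sobolev inequality in the subcritical case. -/
theorem exists_sobolev (hb : 0 < b) (hδ : 0 < δ) (ha : 0 < a) (hκ : 0 < κ) (m : ℝ≥0) :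
    ∃ C : ℝ, 0 < C ∧
      ∀ (X : Type u) [MetricSpace X] [MeasurableSpace X] [BorelSpace X] (μ : Measure X)
        (Q p s ε : X → ℝ) (q : X → ℝ≥0∞),
        Setting μ b δ D a A L κ Q p s ε → μ univ = m → IsExponent μ q →
        (∀ᵐ x ∂μ, κ ≤ Q x - ε x * p x) →
        ∀ (u : X → EReal) (g : ℤ → X → ℝ≥0∞), MemBesov μ s p q u →
          IsVectorGradient μ s u g → MemMixed μ p q g →
          luxNorm μ (fun x => Q x * p x / (Q x - ε x * p x)) (fun x => (u x).abs)
            ≤ ENNReal.ofReal C *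
              (luxNorm μ p (fun x => (u x).abs) + mixedNorm μ p q g) := by
  have hR : 0 < min δ 1 := lt_min hδ one_pos
  have hR1 : min δ 1 ≤ 1 := min_le_right _ _
  have hA : 0 < max A 1 := by positivity
  obtain ⟨K, hK, hpair⟩ := exists_hajlaszPair.{u} b δ D a A L κ ha hκ
  have hK1 : 0 < K + 1 := by linarith
  obtain ⟨T, hT, hgood⟩ := exists_good_point.{u} (D := D) (A := max A 1)
    (M := logConst a A L) hb hR1 ha hK1
  set T' : ℝ := T * (min δ 1) ^ (-(max A 1 / a)) with hT'
  have hT0 : 0 ≤ T' := by positivity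
  obtain ⟨C, hC, hest⟩ := exists_abs_sub_le_rpow.{u} (D := D) (M := logConst a A L) hb hR hR1 ha
    hA hK1 hκ hT0
  have hC0 : 0 < C + T' := by linarith
  refine ⟨(C + T') * (m + (K + 1) + 1) ^ (1 / a), by positivity, ?_⟩
  intro X _ _ _ μ Q p s ε q hs hm hq hgap u g hu hgrad hmem
  have := hs.isOpenPosMeasure
  have hgap' : ∀ x, κ ≤ Q x - ε x * p x := forall_le_of_ae_le continuous_const
    (hs.exponent_Q.continuous.sub (hs.exponent_ε.continuous.mul hs.exponent_p.continuous)) hgap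
  obtain ⟨h, S, hhm, huS, hl⟩ := hpair hs hq hu.1.1 hgrad hmem
  refine le_ofReal_mul_of_forall_lt (by positivity) fun l hNl => ?_
  have hl0 : 0 < l := pos_of_lt_ofReal hNl
  have hP := hl l (le_add_self.trans_lt hNl)
  have habs : ∀ x ∈ S, (u x).abs / ENNReal.ofReal l = ENNReal.ofReal |(u x).toReal / l| := by
    intro x hx
    simpa using abs_toReal_sub_div (huS x hx) 0 hl0
  have hmod : ∫⁻ x, ENNReal.ofReal (|(u x).toReal / l| ^ p x) ∂μ ≤ 1 := by
    refine (lintegral_mono_ae (hP.ae_mem.mono fun x hx => ?_)).trans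
      (modular_div_le_one_of_luxNorm_lt hs.exponent_p.pos (le_self_add.trans_lt hNl))
    simp only [habs x hx]
    rw [ENNReal.ofReal_rpow_of_nonneg (abs_nonneg _) (hs.exponent_p.pos x).le]
  have hP' := hP.max_abs hK.le (hhm.div_const l) hs.exponent_p.measurable hmod
  have hbound : ∀ x ∈ S, |(u x).toReal / l| ≤
      (C + T') * (max 1 (max (h x / l) |(u x).toReal / l|)) ^ (1 - ε x * p x / Q x) := by
    intro x hx
    obtain ⟨y, hy, -, hHy⟩ := hgood hP' x _ hR le_rfl
    have hHy' : max (h y / l) |(u y).toReal / l| ≤ T' := by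
      refine hHy.trans ?_
      exact mul_le_mul_of_nonneg_left (hP'.rpow_neg_div_le ha hR hR1 x) (by linarith)
    have h1 := hest hP' hgap' x hx y hy hHy'
    have h2 : |(u y).toReal / l| ≤ T' := (le_max_right _ _).trans hHy'
    have h3 : |(u x).toReal / l| ≤
        |(u x).toReal / l - (u y).toReal / l| + |(u y).toReal / l| := by
      simpa using abs_sub_le ((u x).toReal / l) ((u y).toReal / l) 0
    have hQ := hs.exponent_Q.pos x
    have h4 : 1 ≤ (max 1 (max (h x / l) |(u x).toReal / l|)) ^ (1 - ε x * p x / Q x) := by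
      apply Real.one_le_rpow (le_max_left _ _)
      rw [sub_nonneg, div_le_one hQ]
      linarith [hgap' x]
    nlinarith
  refine luxNorm_le (by positivity) ?_
  have := hP'.modular_sobolev_le_one ha hK1.le (fun x => hκ.trans_le (hgap' x)) hm hC0
    (f := fun x => (u x).abs / ENNReal.ofReal l) (fun x hx => by
      rw [habs x hx]
      exact ENNReal.ofReal_le_ofReal (hbound x hx))
  simpa only [div_ofReal_div_ofReal _ hl0] using this

/-- The Moser–Trudinger inequality in the critical case. -/
theorem exists_moser_trudinger (hb : 0 < b) (hδ : 0 < δ) (ha : 0 < a) (hκ : 0 < κ) :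
    ∃ C₁ C₂ : ℝ, 0 < C₁ ∧ 0 < C₂ ∧
      ∀ (X : Type u) [MetricSpace X] [MeasurableSpace X] [BorelSpace X] (μ : Measure X)
        (Q p s ε : X → ℝ) (q : X → ℝ≥0∞),
        Setting μ b δ D a A L κ Q p s ε → IsExponent μ q →
        (∀ x, ε x * p x = Q x) →
        ∀ (u : X → EReal) (g : ℤ → X → ℝ≥0∞), MemHomBesov μ s p q u →
          IsVectorGradient μ s u g → MemMixed μ p q g → 0 < mixedNorm μ p q g →
          Integrable (fun x => (u x).toReal) μ ∧
          ⨍⁻ x, ENNReal.ofReal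
              (Real.exp (C₁ * (|(u x).toReal - mean μ u| / (mixedNorm μ p q g).toReal))) ∂μ
            ≤ ENNReal.ofReal C₂ := by
  have hR : 0 < min δ 1 := lt_min hδ one_pos
  have hR1 : min δ 1 ≤ 1 := min_le_right _ _
  obtain ⟨K, hK, hpair⟩ := exists_hajlaszPair.{u} b δ D a A L κ ha hκ
  obtain ⟨T, hT, hgood⟩ := exists_good_point.{u} (D := D) (A := max A 1)
    (M := logConst a A L) hb hR1 ha hK
  obtain ⟨C, hC, hest⟩ := exists_abs_sub_le_log.{u} (D := D) (M := logConst a A L) (A := max A 1)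
    hb hR hR1 ha hK (T := T * (min δ 1) ^ (-(max A 1 / a))) (by positivity)
  have hC0 : 0 < C := by linarith
  set W : ℝ := 1 + K / (b * (min δ 1) ^ (max A 1)) with hW
  have hW0 : 0 < W := by positivity
  set B : ℝ := C * (1 + 1 / a) * W with hB
  have hB0 : 0 < B := by positivity
  -- With `l = 2 * N`, the coefficient `a / (2 * C)` turns the logarithmic bound into `a * (1 + log
  -- t)`, whose exponential is a multiple of `t ^ a ≤ t ^ p x`; `B` bounds the shift to the mean.
  refine ⟨a / (2 * C), Real.exp (a + a * B / C) * W, by positivity, by positivity, ?_⟩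
  intro X _ _ _ μ Q p s ε q hs hq hcrit u g hu hgrad hmem hpos
  rcases isEmpty_or_nonempty X with hX | ⟨⟨x₀⟩⟩
  · rw [Measure.eq_zero_of_isEmpty μ]
    simp
  have := hs.isOpenPosMeasure
  have : IsFiniteMeasure μ := ⟨hs.measure_univ_lt_top⟩
  have hμ0 : μ ≠ 0 := fun h0 => (hs.ball_pos x₀ 1 one_pos).ne' (by simp [h0])
  obtain ⟨h, S, -, huS, hl⟩ := hpair hs hq hu.1 hgrad hmem
  have hfin := hmem.mixedNorm_lt_top hs.exponent_p.pos hq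
  set N : ℝ := (mixedNorm μ p q g).toReal with hN
  have hN0 : 0 < N := ENNReal.toReal_pos hpos.ne' hfin.ne
  have hl0 : 0 < 2 * N := by positivity
  have hP := hl (2 * N) ((ENNReal.lt_ofReal_iff_toReal_lt hfin.ne).2 (by linarith))
  obtain ⟨y, hy, -, hHy⟩ := hgood hP x₀ _ hR le_rfl
  have hHy' := hHy.trans (mul_le_mul_of_nonneg_left (hP.rpow_neg_div_le ha hR hR1 x₀)
    (by linarith))
  have hlog : ∀ x ∈ S, |(u x).toReal - (u y).toReal| ≤
      2 * N * (C * (1 + Real.log (max 1 (h x / (2 * N))))) := by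
    intro x hx
    have h1 := hest hP hcrit x hx y hy hHy'
    rwa [← sub_div, abs_div, abs_of_pos hl0, div_le_iff₀' hl0] at h1
  have hHa : ∀ x, (max 1 (h x / (2 * N))) ^ a ≤ (max 1 (h x / (2 * N))) ^ p x := fun x =>
    Real.rpow_le_rpow_of_exponent_le (le_max_left _ _) (hP.p_mem x).1
  have hint := hP.lintegral_le_mul_measure_univ hb hR hR1 hK.le x₀
  rw [← hW] at hint
  have hmean := integrable_and_abs_mean_sub_le hμ0 hu.1.1 (c := (u y).toReal) (B := 2 * N * B)
    (by positivity)
    (G := fun x => 2 * N * (C * (1 + 1 / a)) * (max 1 (h x / (2 * N))) ^ p x)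
    (hP.ae_mem.mono fun x hx => by
      refine (hlog x hx).trans ?_
      have ht1 : 1 ≤ max 1 (h x / (2 * N)) := le_max_left _ _
      have h1 := Real.log_le_rpow_div (x := max 1 (h x / (2 * N))) (by linarith) ha
      have h2 : 1 ≤ (max 1 (h x / (2 * N))) ^ p x :=
        Real.one_le_rpow ht1 (hs.exponent_p.pos x).le
      have h3 : (max 1 (h x / (2 * N))) ^ a / a ≤ 1 / a * (max 1 (h x / (2 * N))) ^ p x := by
        rw [one_div, inv_mul_eq_div]
        exact div_le_div_of_nonneg_right (hHa x) ha.le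
      calc 2 * N * (C * (1 + Real.log (max 1 (h x / (2 * N)))))
          ≤ 2 * N * (C * ((max 1 (h x / (2 * N))) ^ p x +
            1 / a * (max 1 (h x / (2 * N))) ^ p x)) := by gcongr; linarith
        _ = _ := by ring)
    (by
      simp_rw [ENNReal.ofReal_mul (show 0 ≤ 2 * N * (C * (1 + 1 / a)) by positivity)]
      rw [lintegral_const_mul' _ _ ENNReal.ofReal_ne_top]
      calc ENNReal.ofReal (2 * N * (C * (1 + 1 / a))) *
            ∫⁻ x, ENNReal.ofReal ((max 1 (h x / (2 * N))) ^ p x) ∂μ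
          ≤ ENNReal.ofReal (2 * N * (C * (1 + 1 / a))) * (ENNReal.ofReal W * μ univ) := by
            gcongr
        _ = _ := by
            rw [← mul_assoc, ← ENNReal.ofReal_mul (by positivity), hB]
            congr 2
            ring)
  refine ⟨hmean.1, ?_⟩
  have hexp : ∀ x ∈ S, Real.exp (a / (2 * C) * (|(u x).toReal - mean μ u| / N)) ≤
      Real.exp (a + a * B / C) * (max 1 (h x / (2 * N))) ^ p x := by
    intro x hx
    have ht0 : 0 < max 1 (h x / (2 * N)) := by positivity
    refine le_trans ?_ (mul_le_mul_of_nonneg_left (hHa x) (Real.exp_pos _).le)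
    rw [Real.rpow_def_of_pos ht0, ← Real.exp_add]
    apply Real.exp_le_exp.2
    have h1 : |(u x).toReal - mean μ u| ≤
        2 * N * (C * (1 + Real.log (max 1 (h x / (2 * N))))) + 2 * N * B := by
      have := abs_sub_le (u x).toReal (u y).toReal (mean μ u)
      rw [abs_sub_comm (u y).toReal] at this
      linarith [hlog x hx, hmean.2]
    calc a / (2 * C) * (|(u x).toReal - mean μ u| / N)
        ≤ a / (2 * C) * ((2 * N * (C * (1 + Real.log (max 1 (h x / (2 * N))))) +
            2 * N * B) / N) := by gcongr
      _ = _ := by field_simp; ring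
  rw [laverage_eq]
  refine ENNReal.div_le_of_le_mul ?_
  calc ∫⁻ x, ENNReal.ofReal (Real.exp (a / (2 * C) * (|(u x).toReal - mean μ u| / N))) ∂μ
      ≤ ∫⁻ x, ENNReal.ofReal (Real.exp (a + a * B / C)) *
          ENNReal.ofReal ((max 1 (h x / (2 * N))) ^ p x) ∂μ :=
        lintegral_mono_ae (hP.ae_mem.mono fun x hx => by
          rw [← ENNReal.ofReal_mul (by positivity)]
          exact ENNReal.ofReal_le_ofReal (hexp x hx))
    _ = ENNReal.ofReal (Real.exp (a + a * B / C)) *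
          ∫⁻ x, ENNReal.ofReal ((max 1 (h x / (2 * N))) ^ p x) ∂μ :=
        lintegral_const_mul' _ _ ENNReal.ofReal_ne_top
    _ ≤ ENNReal.ofReal (Real.exp (a + a * B / C)) * (ENNReal.ofReal W * μ univ) := by gcongr
    _ = _ := by rw [← mul_assoc, ← ENNReal.ofReal_mul (by positivity)]

/-- A function satisfying a variable Hölder estimate on a dense set has an extension with the
same estimate. -/
theorem exists_continuous_extension {X : Type u} [MetricSpace X] {S : Set X} (hS : Dense S)
    {f α : X → ℝ} {C c : ℝ} (hC : 0 ≤ C) (hc : 0 < c) (hα : Continuous α) (hcα : ∀ x, c ≤ α x)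
    (h : ∀ x ∈ S, ∀ y ∈ S, |f x - f y| ≤ C * dist x y ^ α x) :
    ∃ v : X → ℝ, Continuous v ∧ (∀ x ∈ S, v x = f x) ∧
      ∀ x y, |v x - v y| ≤ C * dist x y ^ α x := by
  have hd : DenseRange ((↑) : S → X) := hS.denseRange_val
  have hu : IsUniformInducing ((↑) : S → X) := isUniformEmbedding_subtype_val.isUniformInducing
  have huc : UniformContinuous fun x : S => f x := by
    rw [Metric.uniformContinuous_iff]
    intro η hη
    refine ⟨min 1 ((η / (C + 1)) ^ (1 / c)), by positivity, fun {x y} hxy => ?_⟩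
    have h1 : dist (x : X) y ≤ 1 := (hxy.trans_le (min_le_left _ _)).le
    have h2 : dist (x : X) y < (η / (C + 1)) ^ (1 / c) := hxy.trans_le (min_le_right _ _)
    have h3 : dist (x : X) y ^ α x ≤ η / (C + 1) := by
      calc dist (x : X) y ^ α x ≤ dist (x : X) y ^ c :=
            Real.rpow_le_rpow_of_exponent_ge_of_imp dist_nonneg h1 (hcα x)
              (fun _ h0 => absurd h0 (hc.trans_le (hcα x)).ne')
        _ ≤ ((η / (C + 1)) ^ (1 / c)) ^ c := by gcongr
        _ = η / (C + 1) := by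
            rw [← Real.rpow_mul (by positivity), one_div_mul_cancel hc.ne', Real.rpow_one]
    rw [Real.dist_eq]
    calc |f x - f y| ≤ C * dist (x : X) y ^ α x := h x x.2 y y.2
      _ ≤ C * (η / (C + 1)) := by gcongr
      _ < η := by
          rw [mul_div_assoc', div_lt_iff₀ (by positivity)]
          nlinarith
  have hext := uniformContinuous_uniformly_extend hu hd huc
  have heq := uniformly_extend_of_ind hu hd huc
  refine ⟨_, hext.continuous, fun x hx => heq ⟨x, hx⟩, ?_⟩
  -- Both sides are continuous in the pair, so the estimate passes from `S × S` to the closure;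
  -- positivity of `α` is needed where the distance is 0.
  refine isClosed_property2 hd ?_ ?_
  · refine isClosed_le ?_ ?_
    · exact ((hext.continuous.comp continuous_fst).sub
        (hext.continuous.comp continuous_snd)).abs
    · exact continuous_const.mul (continuous_dist.rpow (hα.comp continuous_fst)
        fun z => Or.inr (hc.trans_le (hcα z.1)))
  · intro x y
    rw [heq, heq]
    exact h x x.2 y y.2

/-- The Morrey estimates in the supercritical case. -/
theorem exists_morrey (hb : 0 < b) (hδ : 0 < δ) (ha : 0 < a) (hκ : 0 < κ) :
    ∃ C₁ C₂ : ℝ, 0 < C₁ ∧ 0 < C₂ ∧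
      ∀ (X : Type u) [MetricSpace X] [MeasurableSpace X] [BorelSpace X] (μ : Measure X)
        (Q p s ε : X → ℝ) (q : X → ℝ≥0∞),
        Setting μ b δ D a A L κ Q p s ε → IsExponent μ q →
        (∀ᵐ x ∂μ, κ ≤ ε x * p x - Q x) →
        ∀ (u : X → EReal) (g : ℤ → X → ℝ≥0∞), MemHomBesov μ s p q u →
          IsVectorGradient μ s u g → MemMixed μ p q g →
          Integrable (fun x => (u x).toReal) μ ∧
          eLpNorm (fun x => (u x).toReal - mean μ u) ∞ μ
            ≤ ENNReal.ofReal C₁ * mixedNorm μ p q g ∧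
          ∃ v : X → ℝ, Continuous v ∧ (∀ᵐ x ∂μ, u x = (v x : EReal)) ∧
            ∀ x y, ENNReal.ofReal |v x - v y| ≤
              ENNReal.ofReal C₂ * mixedNorm μ p q g *
                ENNReal.ofReal (dist x y ^ (ε x - Q x / p x)) := by
  have hR : 0 < min δ 1 := lt_min hδ one_pos
  have hR1 : min δ 1 ≤ 1 := min_le_right _ _
  have hA : 0 < max A 1 := by positivity
  obtain ⟨K, hK, hpair⟩ := exists_hajlaszPair.{u} b δ D a A L κ ha hκ
  obtain ⟨C, hC, hest⟩ := exists_abs_sub_le_dist_rpow.{u} (D := D) (M := logConst a A L) hb hR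
    hR1 ha hA hK hκ
  have hC0 : 0 < C := by linarith
  -- One `C` compares `u` with its value at a reference point, the other compares that value with
  -- the mean.
  refine ⟨2 * C, C, by positivity, hC0, ?_⟩
  intro X _ _ _ μ Q p s ε q hs hq hgap u g hu hgrad hmem
  rcases isEmpty_or_nonempty X with hX | ⟨⟨x₀⟩⟩
  · rw [Measure.eq_zero_of_isEmpty μ]
    refine ⟨by simp, by simp, fun _ => 0, continuous_const, by simp, fun x => hX.elim x⟩
  have := hs.isOpenPosMeasure
  have : IsFiniteMeasure μ := ⟨hs.measure_univ_lt_top⟩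
  have hμ0 : μ ≠ 0 := fun h0 => (hs.ball_pos x₀ 1 one_pos).ne' (by simp [h0])
  have hgap' : ∀ x, κ ≤ ε x * p x - Q x := forall_le_of_ae_le continuous_const
    ((hs.exponent_ε.continuous.mul hs.exponent_p.continuous).sub hs.exponent_Q.continuous) hgap
  have hα := hs.logComparable_sub_div ha
  have hακ : ∀ x, κ / max A 1 ≤ ε x - Q x / p x := by
    intro x
    have hp := hs.exponent_p.pos x
    have e : ε x - Q x / p x = (ε x * p x - Q x) / p x := by field_simp
    rw [e]
    have := hgap' x
    have := (hs.exponent_p.mem_Icc x).2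
    gcongr
    · linarith
  obtain ⟨h, S, -, huS, hl⟩ := hpair hs hq hu.1 hgrad hmem
  have hfin := hmem.mixedNorm_lt_top hs.exponent_p.pos hq
  set N : ℝ := (mixedNorm μ p q g).toReal with hN
  have hNof : mixedNorm μ p q g = ENNReal.ofReal N := (ENNReal.ofReal_toReal hfin.ne).symm
  have hN0 : 0 ≤ N := ENNReal.toReal_nonneg
  have hNl : ∀ l, N < l → mixedNorm μ p q g < ENNReal.ofReal l := fun l hl =>
    (ENNReal.lt_ofReal_iff_toReal_lt hfin.ne).2 hl
  have hSae : ∀ᵐ x ∂μ, x ∈ S := (hl (N + 1) (hNl _ (by linarith))).ae_mem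
  have hdense : Dense S := Measure.dense_of_ae hSae
  have hscale : ∀ l, N < l → ∀ x ∈ S, ∀ y ∈ S, |(u x).toReal - (u y).toReal| ≤ l * C ∧
      |(u x).toReal - (u y).toReal| ≤ l * (C * dist x y ^ (ε x - Q x / p x)) := by
    intro l hNl' x hx y hy
    have hl0 : 0 < l := hN0.trans_lt hNl'
    have h1 := hest (hl l (hNl l hNl')) hgap' hα x hx y hy
    rwa [← sub_div, abs_div, abs_of_pos hl0, div_le_iff₀' hl0, div_le_iff₀' hl0] at h1
  have hbdd : ∀ x ∈ S, ∀ y ∈ S, |(u x).toReal - (u y).toReal| ≤ N * C := fun x hx y hy =>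
    le_mul_of_forall_lt_le_mul fun l hl => (hscale l hl x hx y hy).1
  have hhol : ∀ x ∈ S, ∀ y ∈ S, |(u x).toReal - (u y).toReal| ≤
      N * C * dist x y ^ (ε x - Q x / p x) := fun x hx y hy => by
    rw [mul_assoc]
    exact le_mul_of_forall_lt_le_mul fun l hl => (hscale l hl x hx y hy).2
  obtain ⟨y, hy⟩ : S.Nonempty := by
    have : Nonempty X := ⟨x₀⟩
    exact hdense.nonempty
  have hmean := integrable_and_abs_mean_sub_le hμ0 hu.1.1 (c := (u y).toReal) (B := N * C)
    (by positivity) (G := fun _ => N * C) (hSae.mono fun x hx => hbdd x hx y hy)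
    (by rw [lintegral_const])
  refine ⟨hmean.1, ?_, ?_⟩
  · rw [eLpNorm_exponent_top, hNof, ← ENNReal.ofReal_mul (by positivity)]
    refine eLpNormEssSup_le_of_ae_bound (hSae.mono fun x hx => ?_)
    rw [Real.norm_eq_abs]
    have h1 := abs_sub_le (u x).toReal (u y).toReal (mean μ u)
    rw [abs_sub_comm (u y).toReal] at h1
    linarith [hbdd x hx y hy, hmean.2]
  · obtain ⟨v, hvc, hvS, hv⟩ := exists_continuous_extension hdense (by positivity)
      (by positivity : 0 < κ / max A 1) hα.continuous hακ hhol
    refine ⟨v, hvc, hSae.mono fun x hx => by rw [hvS x hx]; exact huS x hx, fun x y => ?_⟩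
    rw [hNof, ← ENNReal.ofReal_mul hC0.le, ← ENNReal.ofReal_mul (by positivity), mul_comm C]
    exact ENNReal.ofReal_le_ofReal (hv x y)

end Main

end VarBesov

theorem mainTheorem11 (b δ D a A L κ : ℝ) (hb : 0 < b) (hb1 : b ≤ 1) (hδ : 0 < δ)
    (ha : 0 < a) (hκ : 0 < κ) :
    -- (i) the case `ε p ≪ Q`
    (∀ M : ℝ≥0, ∃ C : ℝ, 0 < C ∧
      ∀ (X : Type u) [MetricSpace X] [MeasurableSpace X] [BorelSpace X] (μ : Measure X)
        (Q p s ε : X → ℝ) (q : X → ℝ≥0∞),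
        Setting μ b δ D a A L κ Q p s ε → μ univ = M → IsExponent μ q →
        (∀ᵐ x ∂μ, κ ≤ Q x - ε x * p x) →
        (∀ (u : X → EReal) (g : ℤ → X → ℝ≥0∞), MemHomBesov μ s p q u →
          IsVectorGradient μ s u g → MemMixed μ p q g →
          ⨅ c : ℝ, luxNorm μ (fun x => Q x * p x / (Q x - ε x * p x))
              (fun x => (u x - (c : EReal)).abs)
            ≤ ENNReal.ofReal C * mixedNorm μ p q g) ∧
        (∀ (u : X → EReal) (g : ℤ → X → ℝ≥0∞), MemBesov μ s p q u →
          IsVectorGradient μ s u g → MemMixed μ p q g →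
          luxNorm μ (fun x => Q x * p x / (Q x - ε x * p x)) (fun x => (u x).abs)
            ≤ ENNReal.ofReal C *
              (luxNorm μ p (fun x => (u x).abs) + mixedNorm μ p q g))) ∧
    -- (ii) the case `ε p = Q`
    (∃ C₁ C₂ : ℝ, 0 < C₁ ∧ 0 < C₂ ∧
      ∀ (X : Type u) [MetricSpace X] [MeasurableSpace X] [BorelSpace X] (μ : Measure X)
        (Q p s ε : X → ℝ) (q : X → ℝ≥0∞),
        Setting μ b δ D a A L κ Q p s ε → IsExponent μ q →
        (∀ x, ε x * p x = Q x) →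
        ∀ (u : X → EReal) (g : ℤ → X → ℝ≥0∞), MemHomBesov μ s p q u →
          IsVectorGradient μ s u g → MemMixed μ p q g → 0 < mixedNorm μ p q g →
          Integrable (fun x => (u x).toReal) μ ∧
          ⨍⁻ x, ENNReal.ofReal
              (Real.exp (C₁ * (|(u x).toReal - mean μ u| / (mixedNorm μ p q g).toReal))) ∂μ
            ≤ ENNReal.ofReal C₂) ∧
    -- (iii) the case `ε p ≫ Q`
    (∃ C₁ C₂ : ℝ, 0 < C₁ ∧ 0 < C₂ ∧
      ∀ (X : Type u) [MetricSpace X] [MeasurableSpace X] [BorelSpace X] (μ : Measure X)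
        (Q p s ε : X → ℝ) (q : X → ℝ≥0∞),
        Setting μ b δ D a A L κ Q p s ε → IsExponent μ q →
        (∀ᵐ x ∂μ, κ ≤ ε x * p x - Q x) →
        ∀ (u : X → EReal) (g : ℤ → X → ℝ≥0∞), MemHomBesov μ s p q u →
          IsVectorGradient μ s u g → MemMixed μ p q g →
          Integrable (fun x => (u x).toReal) μ ∧
          eLpNorm (fun x => (u x).toReal - mean μ u) ∞ μ
            ≤ ENNReal.ofReal C₁ * mixedNorm μ p q g ∧
          ∃ v : X → ℝ, Continuous v ∧ (∀ᵐ x ∂μ, u x = (v x : EReal)) ∧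
            ∀ x y, ENNReal.ofReal |v x - v y| ≤
              ENNReal.ofReal C₂ * mixedNorm μ p q g *
                ENNReal.ofReal (dist x y ^ (ε x - Q x / p x))) := by
  refine ⟨fun M => ?_, exists_moser_trudinger hb hδ ha hκ, exists_morrey hb hδ ha hκ⟩
  obtain ⟨C, hC, h1⟩ := exists_sobolev_poincare.{u} (D := D) (A := A) (L := L) hb hδ ha hκ M
  obtain ⟨C', -, h2⟩ := exists_sobolev.{u} (D := D) (A := A) (L := L) hb hδ ha hκ M
  refine ⟨max C C', lt_max_of_lt_left hC, ?_⟩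
  intro X _ _ _ μ Q p s ε q hs hm hq hgap
  refine ⟨fun u g hu hg hmem => (h1 X μ Q p s ε q hs hm hq hgap u g hu hg hmem).trans ?_,
    fun u g hu hg hmem => (h2 X μ Q p s ε q hs hm hq hgap u g hu hg hmem).trans ?_⟩
  · gcongr; exact le_max_left _ _
  · gcongr; exact le_max_right _ _
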